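/- Let $0<\sigma<1$, let $\Gamma\subset\mathbb C$ be an analytic Jordan curve (the image of a $2\pi$-periodic real-analytic map $\gamma:\mathbb R\to\mathbb C$ that is injective on $[0,2\pi)$ with $\gamma'\neq0$), let $\Omega$ be the bounded domain with boundary $\Gamma$, and let $\Omega'=\widehat{\mathbb C}\setminus\overline\Omega$. Orient $\Gamma$ positively with respect to $\Omega$. Let $\Lambda_\sigma(\Gamma)$ be the space of complex-valued functions on $\Gamma$ that are Hölder continuous of order $\sigma$. Let $A(\Omega)$ be the space of $\sigma$-Hölder continuous functions on $\overline\Omega$ that are analytic in $\Omega$, and $A(\Omega')$ the space of $\sigma$-Hölder continuous functions on $\Omega'\cup\Gamma$ that are analytic in $\Omega'$ and vanish at $\infty$. For $F\in\Lambda_\sigma(\Gamma)$ let $\Pi F$ be the boundary values on $\Gamma$, taken from $\Omega$, of the double layer potential $$u(z)=\frac1\pi\int_\Gamma F(\zeta)\,\frac{\partial}{\partial N_\zeta}\log|z-\zeta|\,ds_\zeta,$$ where $N_\zeta$ is the outward unit normal and $ds$ is arc length, and let $HF$ be the boundary values on $\Gamma$, taken from $\Omega$, of the Cauchy integral $\frac1{2\pi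 i}\int_\Gamma\frac{F(\zeta)}{\zeta-z}\,d\zeta$. These boundary values exist at every point of $\Gamma$, $H$ and $\Pi$ map $\Lambda_\sigma(\Gamma)$ into itself, and $\Pi=H+CHC$, where $C$ is complex conjugation. Theorem 1.20. There is $F\in\Lambda_\sigma(\Gamma)$ with $F\not\equiv0$ and $\Pi F=F$ if and only if there exist non-constant $f\in A(\Omega)$ and $g\in A(\Omega')$ with $f=\overline g$ on $\Gamma$. Moreover, if $f$ and $g$ are such functions, then the restrictions of $f$ and $g$ to $\Gamma$ are both fixed points of $\Pi$. -/

import Mathlib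

open Set Filter Topology MeasureTheory
open scoped NNReal ComplexConjugate

noncomputable section

namespace DoubleLayer

/-- A regular real-analytic parametrization, with period `2π`, of an analytic Jordan curve without
cusps. The curve itself is `range γ`. -/
structure IsAnalyticJordanCurve (γ : ℝ → ℂ) : Prop where
  analytic : AnalyticOnNhd ℝ γ univ
  periodic : Function.Periodic γ (2 * Real.pi)
  deriv_ne_zero : ∀ t, deriv γ t ≠ 0
  injOn : InjOn γ (Ico 0 (2 * Real.pi))

/-- `Ω` is the bounded plane domain whose boundary is the analytic Jordan curve `γ`, and `γ` is
positively oriented with respect to `Ω` (winding number one around the points of `Ω`). -/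
structure IsJordanDomain (γ : ℝ → ℂ) (Ω : Set ℂ) : Prop where
  curve : IsAnalyticJordanCurve γ
  isOpen : IsOpen Ω
  isConnected : IsConnected Ω
  isBounded : Bornology.IsBounded Ω
  frontier_eq : frontier Ω = range γ
  winding : ∀ z ∈ Ω,
    (2 * Real.pi * Complex.I)⁻¹ * ∫ t in (0 : ℝ)..2 * Real.pi, deriv γ t / (γ t - z) = 1

/-- The space of complex-valued functions on `Γ` that are Hölder continuous of order `σ`. -/
def HolderSpace (σ : ℝ≥0) (Γ : Set ℂ) : Set (Γ → ℂ) :=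
  {F | ∃ C : ℝ≥0, HolderWith C σ F}

/-- The outward unit normal at `γ t`, for a positively oriented `γ`: the unit tangent vector turned
clockwise by a right angle. -/
def outwardNormal (γ : ℝ → ℂ) (t : ℝ) : ℂ :=
  -Complex.I * (deriv γ t / (‖deriv γ t‖ : ℂ))

/-- The double layer potential
`z ↦ (1/π) ∫_Γ F(ζ) (∂/∂N_ζ) log |z - ζ| ds_ζ` of the dipole density `F`,
with arc length element `ds = |γ'(t)| dt`. -/
def doubleLayerPotential (γ : ℝ → ℂ) (F : range γ → ℂ) (z : ℂ) : ℂ :=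
  (Real.pi : ℂ)⁻¹ * ∫ t in (0 : ℝ)..2 * Real.pi,
    F (rangeFactorization γ t) *
      ((lineDeriv ℝ (fun ζ : ℂ => Real.log ‖z - ζ‖) (γ t) (outwardNormal γ t) *
        ‖deriv γ t‖ : ℝ) : ℂ)

/-- The Cauchy integral `z ↦ (1/(2πi)) ∫_Γ F(ζ)/(ζ - z) dζ`. -/
def cauchyTransform (γ : ℝ → ℂ) (F : range γ → ℂ) (z : ℂ) : ℂ :=
  (2 * Real.pi * Complex.I)⁻¹ * ∫ t in (0 : ℝ)..2 * Real.pi,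
    F (rangeFactorization γ t) / (γ t - z) * deriv γ t

/-- Boundary values from `Ω` on `Γ` of a function `u` in `Ω` (meaningful where the limits exist). -/
def boundaryValues (Γ Ω : Set ℂ) (u : ℂ → ℂ) : Γ → ℂ :=
  fun ζ => limUnder (𝓝[Ω] (ζ : ℂ)) u

/-- The boundary values from `Ω` on `Γ` exist at every point. -/
def HasBoundaryValues (Γ Ω : Set ℂ) (u : ℂ → ℂ) : Prop :=
  ∀ ζ : Γ, ∃ w : ℂ, Tendsto u (𝓝[Ω] (ζ : ℂ)) (𝓝 w)

/-- The operator `Π`: boundary values from `Ω` of the double layer potential. -/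
def doubleLayerOp (γ : ℝ → ℂ) (Ω : Set ℂ) (F : range γ → ℂ) : range γ → ℂ :=
  boundaryValues (range γ) Ω (doubleLayerPotential γ F)

/-- The Hilbert operator `H`: boundary values from `Ω` of the Cauchy integral. -/
def hilbertOp (γ : ℝ → ℂ) (Ω : Set ℂ) (F : range γ → ℂ) : range γ → ℂ :=
  boundaryValues (range γ) Ω (cauchyTransform γ F)

/-- Complex conjugation `C` of functions on `Γ`. -/
def conjOp {Γ : Set ℂ} (F : Γ → ℂ) : Γ → ℂ :=
  fun ζ => conj (F ζ)

/-- The interior space: functions that are `σ`-Hölder on the closure of `Ω` and holomorphic in `Ω`.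
Only the values on `closure Ω` matter. -/
def IsInteriorHolder (σ : ℝ≥0) (Ω : Set ℂ) (f : ℂ → ℂ) : Prop :=
  (∃ C : ℝ≥0, HolderOnWith C σ f (closure Ω)) ∧ DifferentiableOn ℂ f Ω

/-- The exterior space: functions that are `σ`-Hölder on the closed exterior
`(closure Ω)ᶜ ∪ ∂Ω`, holomorphic in the exterior and vanishing at infinity. (A function that is
holomorphic near infinity with limit `0` there is holomorphic at the point at infinity, by removal
of the singularity.) Only the values on the closed exterior matter. -/
def IsExteriorHolder (σ : ℝ≥0) (Ω : Set ℂ) (g : ℂ → ℂ) : Prop :=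
  (∃ C : ℝ≥0, HolderOnWith C σ g ((closure Ω)ᶜ ∪ frontier Ω)) ∧
    DifferentiableOn ℂ g (closure Ω)ᶜ ∧ Tendsto g (cocompact ℂ) (𝓝 0)

/-- `f` is not constant on the set `s`. -/
def NonconstantOn (f : ℂ → ℂ) (s : Set ℂ) : Prop :=
  ¬ ∃ c : ℂ, ∀ z ∈ s, f z = c

/-- A pair of non-constant functions of the interior and of the exterior space that are complex
conjugates of each other on the boundary curve. -/
structure IsMatchingPair (σ : ℝ≥0) (Ω : Set ℂ) (f g : ℂ → ℂ) : Prop where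
  interior : IsInteriorHolder σ Ω f
  exterior : IsExteriorHolder σ Ω g
  nonconstant_left : NonconstantOn f (closure Ω)
  nonconstant_right : NonconstantOn g ((closure Ω)ᶜ ∪ frontier Ω)
  conj_eq : ∀ ζ ∈ frontier Ω, f ζ = conj (g ζ)

end DoubleLayer

end

/-!
Write `Φ(z) = (1/2πi) ∫ F(ζ)/(ζ - z) dζ`, with boundary values `Φ₁` from `Ω` and `Φ₀` from the
exterior, and `Ψ`, `Ψ₁`, `Ψ₀` for the same objects with `conj F` in place of `F`. Everything rests
on three facts.

* *Plemelj and Privalov* (`exists_norm_cauchyExtension_sub_le`, `cauchyExtension_one_sub_zero`): on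
  either side of the curve `Φ` is Hölder continuous of order `σ` up to the boundary, and
  `Φ₁ - Φ₀ = F`. If `γ a` is the point of the curve nearest to `z` and `k` is the winding number
  around `z`, then `Φ(z) = (1/2πi) ∫ (F(ζ) - F(γ a))/(ζ - z) dζ + k F(γ a)`, and the right-hand side
  makes sense on the curve too: it serves as the definition `cauchyExtension` of the boundary
  values, so that the jump relation is immediate and only one Hölder estimate has to be proved.
* *Topology* (`IsJordanDomain.windingNumber_exterior`): the winding number is `0` in the exterior.
  Every component of the complement of the curve has boundary points on the curve and hence contains
  one of its two one-sided collars, and one collar lies in `Ω`; so the exterior is connected, and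
  the winding number is constant there and tends to `0` at infinity.
* *Painlevé and Liouville* (`eq_zero_of_eqOn_boundary`): if a function of the interior space and one
  of the exterior space agree on the curve, both vanish. Locally the curve is the image of the real
  line under a biholomorphic map, and the line is removable for continuous functions by Morera's
  theorem; so the two functions make up an entire function vanishing at infinity.

The jump relation and the last fact show that the Cauchy integral of `f ∈ A(Ω)` is `f` in `Ω`, and
that of `g ∈ A(Ω')` is `0` in `Ω`. As `Π = H + CHC` follows from comparing the kernels, `f = conj g`
on the curve gives `Π f = f` and `Π g = g`. Conversely `Π F = F` reads `Φ₁ + conj Ψ₁ = F`, and with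
the two jump relations this says that `Ψ₁ = conj (-Φ₀)` and `Φ₁ = conj (-Ψ₀)`. A pair of this kind
with a constant member vanishes on the curve; as `F ≠ 0`, one of the two pairs is non-constant.
-/

open Set Filter Topology MeasureTheory
open scoped NNReal ComplexConjugate

noncomputable section

namespace DoubleLayer

/-! ### Quantitative regularity of analytic Jordan curves -/

/-- Quantitative regularity of a closed curve: the chord-arc inequality for parameters at distance
at most `3π/2` (any bound below the period would do; the margin beyond `π` lets one integrate over
a period centred at one parameter while estimating from another one), two-sided bounds for the
speed, and a uniform second order Taylor bound, for a continuously differentiable map. -/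
structure ChordArc (γ : ℝ → ℂ) (c L M : ℝ) : Prop where
  differentiable : Differentiable ℝ γ
  continuous_deriv : Continuous (deriv γ)
  periodic : Function.Periodic γ (2 * Real.pi)
  pos : 0 < c
  lower : ∀ s t, |t - s| ≤ 3 * Real.pi / 2 → c * |t - s| ≤ ‖γ t - γ s‖
  le_deriv : ∀ t, c ≤ ‖deriv γ t‖
  deriv_le : ∀ t, ‖deriv γ t‖ ≤ L
  lip : ∀ s t, ‖γ t - γ s‖ ≤ L * |t - s|
  taylor : ∀ s t, ‖γ t - γ s - ((t - s : ℝ) : ℂ) * deriv γ s‖ ≤ M * |t - s| ^ 2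

lemma isCompact_range_of_periodic {f : ℝ → ℂ} (hf : Continuous f)
    (hp : Function.Periodic f (2 * Real.pi)) : IsCompact (range f) :=
  hp.compact_of_continuous (by positivity) hf

lemma exists_norm_le_of_periodic {f : ℝ → ℂ} (hf : Continuous f)
    (hp : Function.Periodic f (2 * Real.pi)) : ∃ C, ∀ t, ‖f t‖ ≤ C := by
  obtain ⟨C, hC⟩ := (isCompact_range_of_periodic hf hp).isBounded.exists_norm_le
  exact ⟨C, fun t => hC _ (mem_range_self t)⟩

lemma periodic_deriv {f : ℝ → ℂ} {T : ℝ} (hp : Function.Periodic f T) :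
    Function.Periodic (deriv f) T := by
  intro t
  rw [← deriv_comp_add_const]
  congr 1
  exact funext hp

/-- Two parameters on an interval of length less than a period give different points. -/
lemma IsAnalyticJordanCurve.eq_of_eq {γ : ℝ → ℂ} (h : IsAnalyticJordanCurve γ) {s t : ℝ}
    (hst : γ t = γ s) (hd : |t - s| < 2 * Real.pi) : t = s := by
  have hp := Real.two_pi_pos
  have key : ∀ u, γ (toIcoMod hp 0 u) = γ u := fun u => by
    rw [toIcoMod]; exact h.periodic.sub_zsmul_eq _
  have h1 : toIcoMod hp 0 t = toIcoMod hp 0 s := by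
    apply h.injOn
    · simpa using toIcoMod_mem_Ico hp 0 t
    · simpa using toIcoMod_mem_Ico hp 0 s
    · rw [key, key, hst]
  obtain ⟨n, hn⟩ := (toIcoMod_eq_toIcoMod hp).1 h1
  have h2 : |(n : ℝ)| * (2 * Real.pi) < 1 * (2 * Real.pi) := by
    rw [abs_sub_comm, hn, zsmul_eq_mul, abs_mul, abs_of_pos hp] at hd
    linarith
  have h3 : |n| < 1 := by
    have := lt_of_mul_lt_mul_right h2 hp.le
    exact_mod_cast this
  have h4 : n = 0 := Int.abs_lt_one_iff.1 h3
  rw [h4] at hn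
  simp at hn
  linarith

lemma IsAnalyticJordanCurve.differentiable {γ : ℝ → ℂ} (h : IsAnalyticJordanCurve γ) :
    Differentiable ℝ γ := fun t => (h.analytic t (mem_univ t)).differentiableAt

lemma IsAnalyticJordanCurve.continuous_deriv {γ : ℝ → ℂ} (h : IsAnalyticJordanCurve γ) :
    Continuous (deriv γ) := by
  have := h.analytic.deriv
  exact continuous_iff_continuousAt.2 fun t => (this t (mem_univ t)).continuousAt

lemma norm_sub_le_of_norm_deriv_le {f : ℝ → ℂ} (hf : Differentiable ℝ f) {C : ℝ}
    (hC : ∀ t, ‖deriv f t‖ ≤ C) (s t : ℝ) : ‖f t - f s‖ ≤ C * |t - s| := by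
  have := convex_univ.norm_image_sub_le_of_norm_deriv_le (f := f) (x := s) (y := t)
    (fun x _ => hf x) (fun x _ => hC x) (mem_univ _) (mem_univ _)
  simpa using this

lemma IsAnalyticJordanCurve.exists_chordArc {γ : ℝ → ℂ} (h : IsAnalyticJordanCurve γ) :
    ∃ c L M, ChordArc γ c L M := by
  have hd := h.differentiable
  have hc' := h.continuous_deriv
  have hpi := Real.pi_pos
  obtain ⟨L, hL⟩ := exists_norm_le_of_periodic hc' (periodic_deriv h.periodic)
  have hA2 : AnalyticOnNhd ℝ (deriv (deriv γ)) univ := h.analytic.deriv.deriv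
  obtain ⟨M, hM⟩ := exists_norm_le_of_periodic
    (continuous_iff_continuousAt.2 fun t => (hA2 t (mem_univ t)).continuousAt)
    (periodic_deriv (periodic_deriv h.periodic))
  have hd2 : Differentiable ℝ (deriv γ) :=
    fun t => (h.analytic.deriv t (mem_univ t)).differentiableAt
  obtain ⟨m, hm0, hm⟩ : ∃ m, 0 < m ∧ ∀ t, m ≤ ‖deriv γ t‖ := by
    obtain ⟨m, hm0, hm⟩ :=
      (isCompact_range_of_periodic hc' (periodic_deriv h.periodic)).exists_forall_le'
      (f := fun z => ‖z‖) continuous_norm.continuousOn (a := 0)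
      (by rintro _ ⟨t, rfl⟩; exact norm_pos_iff.2 (h.deriv_ne_zero t))
    exact ⟨m, hm0, fun t => hm _ (mem_range_self t)⟩
  have hM0 : 0 ≤ M := (norm_nonneg _).trans (hM 0)
  have taylor : ∀ s t, ‖γ t - γ s - ((t - s : ℝ) : ℂ) * deriv γ s‖ ≤ M * |t - s| ^ 2 := by
    intro s t
    set g : ℝ → ℂ := fun u => γ u - ((u - s : ℝ) : ℂ) * deriv γ s with hg
    have hgd : ∀ u, HasDerivAt g (deriv γ u - deriv γ s) u := by
      intro u
      have h1 : HasDerivAt (fun u : ℝ => ((u - s : ℝ) : ℂ)) 1 u := by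
        simpa using ((hasDerivAt_id u).sub_const s).ofReal_comp
      have h2 := (hd u).hasDerivAt.fun_sub (h1.mul_const (deriv γ s))
      rwa [one_mul] at h2
    have := (convex_uIcc s t).norm_image_sub_le_of_norm_hasDerivWithin_le (f := g)
      (f' := fun u => deriv γ u - deriv γ s) (C := M * |t - s|) (x := s) (y := t)
      (fun x _ => (hgd x).hasDerivWithinAt) (fun x hx => by
        refine (norm_sub_le_of_norm_deriv_le hd2 hM s x).trans ?_
        exact mul_le_mul_of_nonneg_left (abs_sub_left_of_mem_uIcc hx) hM0)
      left_mem_uIcc right_mem_uIcc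
    simp only [hg, sub_self, Complex.ofReal_zero, zero_mul, sub_zero, Real.norm_eq_abs] at this
    calc _ = ‖γ t - ((t - s : ℝ) : ℂ) * deriv γ s - γ s‖ := by congr 1; ring
      _ ≤ _ := this
      _ = _ := by ring
  -- On short chords the Taylor bound gives the lower estimate, on long ones compactness does.
  set η := m / (2 * (M + 1)) with hη
  have hη0 : 0 < η := by positivity
  set K : Set (ℝ × ℝ) := (Icc 0 (2 * Real.pi) ×ˢ Icc (-(2 * Real.pi)) (4 * Real.pi)) ∩
    {p | η ≤ |p.2 - p.1| ∧ |p.2 - p.1| ≤ 3 * Real.pi / 2} with hK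
  have hKc : IsCompact K := by
    refine (isCompact_Icc.prod isCompact_Icc).inter_right ?_
    have hcont : Continuous fun p : ℝ × ℝ => |p.2 - p.1| := (continuous_snd.sub continuous_fst).abs
    exact (isClosed_le continuous_const hcont).inter (isClosed_le hcont continuous_const)
  obtain ⟨m', hm'0, hm'⟩ := hKc.exists_forall_le' (f := fun p : ℝ × ℝ => ‖γ p.2 - γ p.1‖)
    (by have := hd.continuous; fun_prop) (a := 0) (by
      rintro ⟨s, t⟩ ⟨-, h1, h2⟩
      simp only at h1 h2
      refine norm_pos_iff.2 (sub_ne_zero.2 fun he => ?_)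
      have : t = s := h.eq_of_eq he (by linarith)
      rw [this] at h1
      simp at h1
      linarith)
  have lower : ∀ s t, |t - s| ≤ 3 * Real.pi / 2 →
      min (m / 2) (m' / (3 * Real.pi / 2)) * |t - s| ≤ ‖γ t - γ s‖ := by
    intro s t hst
    by_cases hsm : |t - s| ≤ η
    · have h1 := taylor s t
      have h2 : |t - s| * m ≤ ‖((t - s : ℝ) : ℂ) * deriv γ s‖ := by
        rw [norm_mul, Complex.norm_real, Real.norm_eq_abs]
        gcongr
        exact hm s
      have h3 : ‖((t - s : ℝ) : ℂ) * deriv γ s‖ ≤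
          ‖γ t - γ s‖ + ‖γ t - γ s - ((t - s : ℝ) : ℂ) * deriv γ s‖ := by
        have := norm_sub_le (γ t - γ s) (γ t - γ s - ((t - s : ℝ) : ℂ) * deriv γ s)
        simpa using this
      have h4 : M * |t - s| ≤ m / 2 := by
        calc M * |t - s| ≤ (M + 1) * η := by gcongr; linarith
          _ = m / 2 := by rw [hη]; field_simp
      have h5 : M * |t - s| ^ 2 ≤ m / 2 * |t - s| := by
        rw [sq, ← mul_assoc]; gcongr
      have h6 : min (m / 2) (m' / (3 * Real.pi / 2)) * |t - s| ≤ m / 2 * |t - s| := by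
        gcongr; exact min_le_left _ _
      linarith
    · push Not at hsm
      set k := toIcoDiv Real.two_pi_pos 0 s
      have hk := toIcoMod_mem_Ico Real.two_pi_pos 0 s
      rw [toIcoMod] at hk
      rw [zero_add] at hk
      have e1 : γ (s - k • (2 * Real.pi)) = γ s := h.periodic.sub_zsmul_eq _
      have e2 : γ (t - k • (2 * Real.pi)) = γ t := h.periodic.sub_zsmul_eq _
      have e3 : (t - k • (2 * Real.pi)) - (s - k • (2 * Real.pi)) = t - s := by ring
      have h0 := abs_le.1 hst
      have h1 : m' ≤ ‖γ t - γ s‖ := by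
        have := hm' (s - k • (2 * Real.pi), t - k • (2 * Real.pi))
          ⟨⟨⟨hk.1, hk.2.le⟩, ⟨by simp only; linarith [hk.1], by simp only; linarith [hk.2]⟩⟩, by
            simp only [mem_ofPred_eq, e3]; exact ⟨hsm.le, hst⟩⟩
        simpa only [e1, e2] using this
      calc min (m / 2) (m' / (3 * Real.pi / 2)) * |t - s|
          ≤ m' / (3 * Real.pi / 2) * (3 * Real.pi / 2) := by
            gcongr; exact min_le_right _ _
        _ = m' := by field_simp
        _ ≤ _ := h1
  refine ⟨_, L, M, ⟨hd, hc', h.periodic, lt_min (by positivity) (by positivity), lower,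
    fun t => ?_, hL, norm_sub_le_of_norm_deriv_le hd hL, taylor⟩⟩
  exact (min_le_left _ _).trans (by linarith [hm t])

/-- Modulo the period, a parameter can be moved to within `π` of a given one. -/
lemma exists_abs_sub_zsmul_le (a b : ℝ) : ∃ n : ℤ, |a - n • (2 * Real.pi) - b| ≤ Real.pi := by
  refine ⟨toIcoDiv Real.two_pi_pos (b - Real.pi) a, ?_⟩
  have := toIcoMod_mem_Ico Real.two_pi_pos (b - Real.pi) a
  rw [toIcoMod] at this
  exact abs_le.2 ⟨by linarith [this.1], by linarith [this.2]⟩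

/-- Every point of the plane has a nearest point on a closed curve. -/
lemma exists_nearest {γ : ℝ → ℂ} (hc : Continuous γ) (hp : Function.Periodic γ (2 * Real.pi))
    (z : ℂ) : ∃ a, ∀ t, ‖γ a - z‖ ≤ ‖γ t - z‖ := by
  obtain ⟨_, ⟨a, rfl⟩, ha⟩ := (isCompact_range_of_periodic hc hp).exists_isMinOn
    (range_nonempty γ) (f := fun w => ‖w - z‖) (by fun_prop)
  exact ⟨a, fun t => ha (mem_range_self t)⟩

section

/-! ### Cauchy integrals of differences near and on the curve -/

lemma norm_integral_right_le {E : Type*} [NormedAddCommGroup E] [NormedSpace ℝ E] {G : ℝ → E}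
    {g : ℝ → ℝ} {a u v : ℝ} (huv : u ≤ v) (hu : 0 ≤ u) (hg : IntervalIntegrable g volume u v)
    (h : ∀ t, t ≠ a → u ≤ |t - a| → |t - a| ≤ v → ‖G t‖ ≤ g |t - a|) :
    ‖∫ t in (a + u)..(a + v), G t‖ ≤ ∫ τ in u..v, g τ := by
  have h1 : ∫ t in (a + u)..(a + v), G t = ∫ τ in u..v, G (a + τ) := by
    rw [intervalIntegral.integral_comp_add_left]
  rw [h1]
  refine intervalIntegral.norm_integral_le_of_norm_le huv (ae_of_all _ fun t ht => ?_) hg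
  have ht0 : 0 < t := hu.trans_lt ht.1
  have h2 := h (a + t) (by simp [ht0.ne']) (by simpa [abs_of_pos ht0] using ht.1.le)
    (by simpa [abs_of_pos ht0] using ht.2)
  simpa [abs_of_pos ht0] using h2

lemma norm_integral_left_le {E : Type*} [NormedAddCommGroup E] [NormedSpace ℝ E] {G : ℝ → E}
    {g : ℝ → ℝ} {a u v : ℝ} (huv : u ≤ v) (hu : 0 ≤ u) (hg : IntervalIntegrable g volume u v)
    (h : ∀ t, t ≠ a → u ≤ |t - a| → |t - a| ≤ v → ‖G t‖ ≤ g |t - a|) :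
    ‖∫ t in (a - v)..(a - u), G t‖ ≤ ∫ τ in u..v, g τ := by
  have h1 : ∫ t in (a - v)..(a - u), G t = ∫ τ in u..v, G (a - τ) := by
    rw [intervalIntegral.integral_comp_sub_left]
  rw [h1]
  refine intervalIntegral.norm_integral_le_of_norm_le huv (ae_of_all _ fun t ht => ?_) hg
  have ht0 : 0 < t := hu.trans_lt ht.1
  have h2 := h (a - t) (by simp [ht0.ne']) (by simpa [abs_of_pos ht0] using ht.1.le)
    (by simpa [abs_of_pos ht0] using ht.2)
  simpa [abs_of_pos ht0] using h2

lemma norm_integral_symm_le {E : Type*} [NormedAddCommGroup E] [NormedSpace ℝ E] {G : ℝ → E}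
    {g : ℝ → ℝ} {a v : ℝ} (hv : 0 ≤ v) (hg : IntervalIntegrable g volume 0 v)
    (hG : IntervalIntegrable G volume (a - v) (a + v))
    (h : ∀ t, t ≠ a → |t - a| ≤ v → ‖G t‖ ≤ g |t - a|) :
    ‖∫ t in (a - v)..(a + v), G t‖ ≤ 2 * ∫ τ in 0..v, g τ := by
  have h1 := norm_integral_left_le hv le_rfl hg (fun t ht _ h2 => h t ht h2)
  have h2 := norm_integral_right_le hv le_rfl hg (fun t ht _ h2 => h t ht h2)
  rw [sub_zero] at h1
  rw [add_zero] at h2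
  have m : a ∈ uIcc (a - v) (a + v) := by
    rw [uIcc_of_le (by linarith)]; constructor <;> linarith
  rw [← intervalIntegral.integral_add_adjacent_intervals
    (hG.mono_set (uIcc_subset_uIcc_left m)) (hG.mono_set (uIcc_subset_uIcc_right m))]
  exact (norm_add_le _ _).trans (by linarith)

/-- The data of a Hölder continuous density on a closed curve, as a function of the parameter. -/
structure HolderDensity (γ φ : ℝ → ℂ) (A σ : ℝ) : Prop where
  continuous : Continuous φ
  periodic : Function.Periodic φ (2 * Real.pi)
  nonneg : 0 ≤ A
  holder : ∀ s t, ‖φ t - φ s‖ ≤ A * ‖γ t - γ s‖ ^ σ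

/-- The integrand of the Cauchy integral of `φ - φ a`. -/
def cauchyDiffKernel (γ φ : ℝ → ℂ) (z : ℂ) (a t : ℝ) : ℂ :=
  (φ t - φ a) * (deriv γ t / (γ t - z))

/-- The Cauchy integral, up to the factor `2πi`, of `φ - φ a`. It converges also for `z` on the
curve, if `a` is a parameter of `z`. -/
def cauchyDiff (γ φ : ℝ → ℂ) (z : ℂ) (a : ℝ) : ℂ :=
  ∫ t in (0 : ℝ)..2 * Real.pi, cauchyDiffKernel γ φ z a t

variable {γ φ : ℝ → ℂ} {c L M A σ : ℝ}

lemma ChordArc.L_nonneg (h : ChordArc γ c L M) : 0 ≤ L := (norm_nonneg _).trans (h.deriv_le 0)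

lemma ChordArc.M_nonneg (h : ChordArc γ c L M) : 0 ≤ M := by
  simpa using (norm_nonneg _).trans (h.taylor 0 1)

lemma cauchyDiffKernel_periodic (h : ChordArc γ c L M) (hφ : HolderDensity γ φ A σ) (z : ℂ)
    (a : ℝ) : Function.Periodic (cauchyDiffKernel γ φ z a) (2 * Real.pi) := by
  intro t
  simp only [cauchyDiffKernel, hφ.periodic t, h.periodic t, periodic_deriv h.periodic t]

lemma measurable_cauchyDiffKernel (h : ChordArc γ c L M) (hφ : HolderDensity γ φ A σ) (z : ℂ)
    (a : ℝ) : Measurable (cauchyDiffKernel γ φ z a) := by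
  have h1 := h.differentiable.continuous.measurable
  have h2 := h.continuous_deriv.measurable
  have h3 := hφ.continuous.measurable
  unfold cauchyDiffKernel
  fun_prop

/-- If `γ a` is a nearest point to `z`, then `‖γ t - z‖` controls `‖γ t - γ a‖`. -/
lemma norm_sub_nearest_le {z : ℂ} {a : ℝ} (ha : ∀ t, ‖γ a - z‖ ≤ ‖γ t - z‖) (t : ℝ) :
    ‖γ t - γ a‖ ≤ 2 * ‖γ t - z‖ := by
  have h1 : ‖γ t - γ a‖ ≤ ‖γ t - z‖ + ‖γ a - z‖ := by
    have := norm_sub_le (γ t - z) (γ a - z)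
    simpa using this
  linarith [ha t]

lemma norm_cauchyDiffKernel_le (h : ChordArc γ c L M) (hφ : HolderDensity γ φ A σ)
    (hσ1 : σ < 1) {z : ℂ} {a : ℝ} (ha : ∀ t, ‖γ a - z‖ ≤ ‖γ t - z‖) {t : ℝ} (hta : t ≠ a)
    (ht : |t - a| ≤ 3 * Real.pi / 2) :
    ‖cauchyDiffKernel γ φ z a t‖ ≤ (2 * A * L * c ^ (σ - 1)) * |t - a| ^ (σ - 1) := by
  have hc := h.pos
  have hL := h.L_nonneg
  have hA := hφ.nonneg
  have hta' : 0 < |t - a| := abs_pos.2 (sub_ne_zero.2 hta)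
  have h0 : 0 < c * |t - a| := by positivity
  have h1 := h.lower a t ht
  have h2 : 0 < ‖γ t - γ a‖ := h0.trans_le h1
  have h3 := norm_sub_nearest_le ha t
  have h4 : 0 < ‖γ t - z‖ := by linarith
  have h5 : ‖γ t - γ a‖ ^ σ = ‖γ t - γ a‖ ^ (σ - 1) * ‖γ t - γ a‖ := by
    rw [← Real.rpow_add_one h2.ne']; ring_nf
  have h6 : ‖γ t - γ a‖ ^ (σ - 1) ≤ (c * |t - a|) ^ (σ - 1) :=
    Real.rpow_le_rpow_of_nonpos h0 h1 (by linarith)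
  rw [cauchyDiffKernel, norm_mul, norm_div]
  calc ‖φ t - φ a‖ * (‖deriv γ t‖ / ‖γ t - z‖)
      ≤ (A * (‖γ t - γ a‖ ^ (σ - 1) * (2 * ‖γ t - z‖))) * (L / ‖γ t - z‖) := by
        have := hφ.holder a t
        rw [h5] at this
        gcongr
        · exact this.trans (by gcongr)
        · exact h.deriv_le t
    _ = 2 * A * L * ‖γ t - γ a‖ ^ (σ - 1) := by field_simp
    _ ≤ 2 * A * L * (c * |t - a|) ^ (σ - 1) := by gcongr
    _ = _ := by rw [Real.mul_rpow hc.le hta'.le]; ring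

lemma intervalIntegrable_const_mul_rpow (hσ0 : 0 < σ) (B u v : ℝ) :
    IntervalIntegrable (fun τ : ℝ => B * τ ^ (σ - 1)) volume u v :=
  (intervalIntegral.intervalIntegrable_rpow' (by linarith)).const_mul _

lemma intervalIntegrable_const_mul_abs_rpow (hσ0 : 0 < σ) (B a v : ℝ) (hv : 0 ≤ v) :
    IntervalIntegrable (fun t : ℝ => B * |t - a| ^ (σ - 1)) volume (a - v) (a + v) := by
  have h0 := intervalIntegrable_const_mul_rpow hσ0 B 0 v
  have h1 : IntervalIntegrable (fun t : ℝ => B * |t - a| ^ (σ - 1)) volume a (a + v) := by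
    have := h0.comp_sub_right a
    rw [zero_add, add_comm v a] at this
    refine this.congr fun t ht => ?_
    rw [uIoc_of_le (by linarith)] at ht
    simp only [abs_of_pos (sub_pos.2 ht.1)]
  have h2 : IntervalIntegrable (fun t : ℝ => B * |t - a| ^ (σ - 1)) volume a (a - v) := by
    have := h0.comp_sub_left a
    rw [sub_zero] at this
    refine this.congr fun t ht => ?_
    rw [uIoc_of_ge (by linarith)] at ht
    simp only [abs_sub_comm t a, abs_of_nonneg (sub_nonneg.2 ht.2)]
  exact h2.symm.trans h1

lemma intervalIntegrable_cauchyDiffKernel (h : ChordArc γ c L M) (hφ : HolderDensity γ φ A σ)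
    (hσ0 : 0 < σ) (hσ1 : σ < 1) {z : ℂ} {a : ℝ} (ha : ∀ t, ‖γ a - z‖ ≤ ‖γ t - z‖) (u v : ℝ) :
    IntervalIntegrable (cauchyDiffKernel γ φ z a) volume u v := by
  have hpi := Real.pi_pos
  have h1 : IntervalIntegrable (cauchyDiffKernel γ φ z a) volume (a - Real.pi) (a + Real.pi) := by
    refine (intervalIntegrable_const_mul_abs_rpow hσ0 (2 * A * L * c ^ (σ - 1)) a Real.pi
      hpi.le).mono_fun (measurable_cauchyDiffKernel h hφ z a).aestronglyMeasurable ?_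
    refine (ae_restrict_iff' measurableSet_uIoc).2 (ae_of_all _ fun t ht => ?_)
    rw [uIoc_of_le (by linarith)] at ht
    have hc := h.pos
    have hL := h.L_nonneg
    have hA := hφ.nonneg
    beta_reduce
    rw [Real.norm_of_nonneg (by positivity)]
    rcases eq_or_ne t a with rfl | hta
    · rw [cauchyDiffKernel, sub_self, zero_mul, norm_zero]; positivity
    · exact norm_cauchyDiffKernel_le h hφ hσ1 ha hta
        (abs_le.2 ⟨by linarith [ht.1], by linarith [ht.2]⟩)
  refine (cauchyDiffKernel_periodic h hφ z a).intervalIntegrable (by positivity)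
    (t := a - Real.pi) ?_ u v
  rwa [show a - Real.pi + 2 * Real.pi = a + Real.pi by ring]

lemma cauchyDiff_eq (h : ChordArc γ c L M) (hφ : HolderDensity γ φ A σ) (z : ℂ) (a b : ℝ) :
    cauchyDiff γ φ z a = ∫ t in (b - Real.pi)..(b + Real.pi), cauchyDiffKernel γ φ z a t := by
  have := (cauchyDiffKernel_periodic h hφ z a).intervalIntegral_add_eq 0 (b - Real.pi)
  rw [zero_add, show b - Real.pi + 2 * Real.pi = b + Real.pi by ring] at this
  exact this

lemma integral_const_mul_rpow (hσ0 : 0 < σ) (B v : ℝ) :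
    ∫ τ in (0 : ℝ)..v, B * τ ^ (σ - 1) = B * (v ^ σ / σ) := by
  rw [intervalIntegral.integral_const_mul, integral_rpow (Or.inl (by linarith))]
  simp [Real.zero_rpow hσ0.ne']

lemma norm_cauchyDiff_le (h : ChordArc γ c L M) (hφ : HolderDensity γ φ A σ)
    (hσ0 : 0 < σ) (hσ1 : σ < 1) {z : ℂ} {a : ℝ} (ha : ∀ t, ‖γ a - z‖ ≤ ‖γ t - z‖) :
    ‖cauchyDiff γ φ z a‖ ≤ 2 * ((2 * A * L * c ^ (σ - 1)) * (Real.pi ^ σ / σ)) := by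
  rw [cauchyDiff_eq h hφ z a a, ← integral_const_mul_rpow hσ0]
  refine norm_integral_symm_le Real.pi_pos.le (intervalIntegrable_const_mul_rpow hσ0 _ _ _)
    (intervalIntegrable_cauchyDiffKernel h hφ hσ0 hσ1 ha _ _) fun t hta ht => ?_
  exact norm_cauchyDiffKernel_le h hφ hσ1 ha hta (by linarith [Real.pi_pos])

/-- The part of `cauchyDiff` coming from a parameter interval of length comparable to `R`. -/
lemma norm_integral_cauchyDiffKernel_near_le (h : ChordArc γ c L M) (hφ : HolderDensity γ φ A σ)
    (hσ0 : 0 < σ) (hσ1 : σ < 1) {z : ℂ} {a : ℝ} (ha : ∀ t, ‖γ a - z‖ ≤ ‖γ t - z‖) {R u v : ℝ}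
    (hR : R ≤ 3 * Real.pi / 2) (huv : u ≤ v) (hu : a - R ≤ u) (hv : v ≤ a + R) :
    ‖∫ t in u..v, cauchyDiffKernel γ φ z a t‖ ≤
      2 * ((2 * A * L * c ^ (σ - 1)) * (R ^ σ / σ)) := by
  have hint := intervalIntegrable_cauchyDiffKernel h hφ hσ0 hσ1 ha
  calc ‖∫ t in u..v, cauchyDiffKernel γ φ z a t‖
      ≤ ∫ t in u..v, ‖cauchyDiffKernel γ φ z a t‖ :=
        intervalIntegral.norm_integral_le_integral_norm huv
    _ ≤ ∫ t in (a - R)..(a + R), ‖cauchyDiffKernel γ φ z a t‖ :=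
        intervalIntegral.integral_mono_interval hu huv hv (ae_of_all _ fun _ => norm_nonneg _)
          (hint _ _).norm
    _ ≤ ‖∫ t in (a - R)..(a + R), ‖cauchyDiffKernel γ φ z a t‖‖ := Real.le_norm_self _
    _ ≤ _ := by
        rw [← integral_const_mul_rpow hσ0]
        refine norm_integral_symm_le (by linarith) (intervalIntegrable_const_mul_rpow hσ0 _ _ _)
          (hint _ _).norm fun t hta ht => ?_
        rw [norm_norm]
        exact norm_cauchyDiffKernel_le h hφ hσ1 ha hta (ht.trans hR)

/-! ### The Hölder estimate near the curve -/

lemma intervalIntegrable_rpow_of_pos (p : ℝ) {u v : ℝ} (hu : 0 < u) (hv : 0 < v) :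
    IntervalIntegrable (fun τ : ℝ => τ ^ p) volume u v := by
  refine intervalIntegral.intervalIntegrable_rpow (Or.inr ?_)
  exact notMem_uIcc_of_lt hu hv

lemma integral_rpow_le {p u v : ℝ} (hp : p < -1) (hu : 0 < u) (huv : u ≤ v) :
    ∫ τ in u..v, τ ^ p ≤ u ^ (p + 1) / (-(p + 1)) := by
  rw [integral_rpow (Or.inr ⟨hp.ne, notMem_uIcc_of_lt hu (hu.trans_le huv)⟩), div_neg, ← neg_div]
  refine div_le_div_of_nonpos_of_le (by linarith) ?_
  have := Real.rpow_nonneg (hu.trans_le huv).le (p + 1)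
  linarith

/-- Let `‖z - w‖ ≤ δ`, and let `γ a`, `γ b` be at distance at most `2δ` from `z`, `w`. For parameters
`t` far from `b` on the scale of `δ`, the difference of the kernels of `cauchyDiff` at `z` and at
`w`, corrected by a multiple of the odd kernel `1 / (t - b)`, is small. -/
lemma norm_cauchyDiffKernel_sub_le (h : ChordArc γ c L M) (hφ : HolderDensity γ φ A σ)
    (hσ0 : 0 < σ) {δ : ℝ} {z w : ℂ} {a b : ℝ} (hzw : ‖z - w‖ ≤ δ)
    (hz : ‖γ a - z‖ ≤ 2 * δ) (hw : ‖γ b - w‖ ≤ 2 * δ) {t : ℝ}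
    (ht : 10 / c * δ ≤ |t - b|) (hδ : 0 < δ) (htπ : |t - b| ≤ 3 * Real.pi / 2) :
    ‖cauchyDiffKernel γ φ z a t - cauchyDiffKernel γ φ w b t - (φ b - φ a) * ((t - b : ℝ) : ℂ)⁻¹‖
      ≤ (4 * A * L ^ σ * L / c ^ 2 * δ) * |t - b| ^ (σ - 2) +
        A * (5 * δ) ^ σ * (2 * M / c + 6 * δ / c * |t - b| ^ (-2 : ℝ)) := by
  have hc := h.pos
  have hL := h.L_nonneg
  have hM := h.M_nonneg
  have hA := hφ.nonneg
  set τ := |t - b| with hτ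
  have hτ0 : 0 < τ := lt_of_lt_of_le (by positivity) ht
  have htb : t - b ≠ 0 := abs_pos.1 hτ0
  have h10 : 10 * δ ≤ c * τ := by
    rw [div_mul_eq_mul_div, div_le_iff₀ hc] at ht; linarith
  have h1 := h.lower b t htπ
  have hbz : ‖γ b - z‖ ≤ 3 * δ := by
    have := norm_sub_le (γ b - w) (z - w)
    rw [sub_sub_sub_cancel_right] at this
    linarith
  have htz : c / 2 * τ ≤ ‖γ t - z‖ := by
    have := norm_sub_le (γ t - z) (γ b - z)
    rw [sub_sub_sub_cancel_right] at this
    linarith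
  have htw : c / 2 * τ ≤ ‖γ t - w‖ := by
    have := norm_sub_le (γ t - w) (γ b - w)
    rw [sub_sub_sub_cancel_right] at this
    linarith
  have hcτ : 0 < c / 2 * τ := by positivity
  have hz0 : γ t - z ≠ 0 := norm_pos_iff.1 (hcτ.trans_le htz)
  have hw0 : γ t - w ≠ 0 := norm_pos_iff.1 (hcτ.trans_le htw)
  have htb' : ((t - b : ℝ) : ℂ) ≠ 0 := by exact_mod_cast htb
  have hba : ‖φ b - φ a‖ ≤ A * (5 * δ) ^ σ := by
    refine (hφ.holder a b).trans ?_
    have : ‖γ b - γ a‖ ≤ 5 * δ := by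
      have := norm_sub_le (γ b - z) (γ a - z)
      rw [sub_sub_sub_cancel_right] at this
      linarith
    gcongr
  have key : cauchyDiffKernel γ φ z a t - cauchyDiffKernel γ φ w b t -
      (φ b - φ a) * ((t - b : ℝ) : ℂ)⁻¹ =
      (φ t - φ b) * deriv γ t * (z - w) / ((γ t - z) * (γ t - w)) -
      (φ b - φ a) * ((γ b - γ t - ((b - t : ℝ) : ℂ) * deriv γ t + (z - γ b)) * (-1) /
        ((γ t - z) * ((t - b : ℝ) : ℂ))) := by
    simp only [cauchyDiffKernel]
    push_cast at htb' ⊢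
    field_simp
    ring
  have e1 : ‖(φ t - φ b) * deriv γ t * (z - w) / ((γ t - z) * (γ t - w))‖ ≤
      (4 * A * L ^ σ * L / c ^ 2 * δ) * τ ^ (σ - 2) := by
    rw [norm_div, norm_mul, norm_mul, norm_mul]
    have i1 : ‖φ t - φ b‖ ≤ A * (L * τ) ^ σ := by
      refine (hφ.holder b t).trans ?_
      have := h.lip b t
      gcongr
    calc _ ≤ A * (L * τ) ^ σ * L * δ / ((c / 2 * τ) * (c / 2 * τ)) := by
          have := h.deriv_le t
          gcongr
      _ = _ := by
          rw [Real.mul_rpow hL hτ0.le, Real.rpow_sub hτ0, Real.rpow_two]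
          field_simp
          ring
  have e2 : ‖(γ b - γ t - ((b - t : ℝ) : ℂ) * deriv γ t + (z - γ b)) * (-1) /
        ((γ t - z) * ((t - b : ℝ) : ℂ))‖ ≤ 2 * M / c + 6 * δ / c * τ ^ (-2 : ℝ) := by
    rw [norm_div, norm_mul, norm_mul, norm_neg, norm_one, mul_one, Complex.norm_real,
      Real.norm_eq_abs, ← hτ]
    have i1 : ‖γ b - γ t - ((b - t : ℝ) : ℂ) * deriv γ t + (z - γ b)‖ ≤ M * τ ^ 2 + 3 * δ := by
      refine (norm_add_le _ _).trans (add_le_add ?_ ?_)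
      · have := h.taylor t b
        rwa [abs_sub_comm b t] at this
      · rwa [norm_sub_rev]
    calc _ ≤ (M * τ ^ 2 + 3 * δ) / ((c / 2 * τ) * τ) := by gcongr
      _ = _ := by
          rw [Real.rpow_neg hτ0.le, Real.rpow_two]
          field_simp
          ring
  rw [key]
  refine (norm_sub_le _ _).trans (add_le_add e1 ?_)
  rw [norm_mul]
  gcongr

lemma integral_inv_symm_cancel (b : ℝ) {ρ v : ℝ} (hρ : 0 < ρ) (hv : 0 < v) :
    (∫ t in (b - v)..(b - ρ), ((t - b : ℝ) : ℂ)⁻¹) +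
      ∫ t in (b + ρ)..(b + v), ((t - b : ℝ) : ℂ)⁻¹ = 0 := by
  have h1 : ∀ u v : ℝ, ∫ t in u..v, ((t - b : ℝ) : ℂ)⁻¹ =
      ((∫ t in (u - b)..(v - b), t⁻¹ : ℝ) : ℂ) := by
    intro u v
    rw [← intervalIntegral.integral_comp_sub_right (fun t : ℝ => t⁻¹) b,
      ← intervalIntegral.integral_ofReal]
    simp
  rw [h1, h1, ← Complex.ofReal_add, Complex.ofReal_eq_zero]
  rw [show b - v - b = -v by ring, show b - ρ - b = -ρ by ring, add_sub_cancel_left,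
    add_sub_cancel_left, integral_inv_of_neg (by linarith) (by linarith),
    integral_inv_of_pos hρ hv, neg_div_neg_eq,
    Real.log_div hρ.ne' hv.ne', Real.log_div hv.ne' hρ.ne']
  ring

/-- The Hölder estimate for `cauchyDiff` at two points which are, relative to their mutual distance,
near the curve. The integrals are split into the parameters near `b`, where the kernels are
estimated separately, and the others, where the leading term `(φ b - φ a) / (t - b)` of the
difference is odd about `b` and integrates to zero. -/
lemma exists_norm_cauchyDiff_sub_le_near (h : ChordArc γ c L M) (hφ : HolderDensity γ φ A σ)
    (hσ0 : 0 < σ) (hσ1 : σ < 1) : ∃ C, 0 ≤ C ∧ ∀ (δ : ℝ) (z w : ℂ) (a b : ℝ), 0 < δ →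
      δ ≤ c * Real.pi / 20 → (∀ t, ‖γ a - z‖ ≤ ‖γ t - z‖) → (∀ t, ‖γ b - w‖ ≤ ‖γ t - w‖) →
      ‖z - w‖ ≤ δ → ‖γ a - z‖ ≤ 2 * δ → ‖γ b - w‖ ≤ 2 * δ →
      ‖cauchyDiff γ φ z a - cauchyDiff γ φ w b‖ ≤ C * δ ^ σ := by
  have hc := h.pos
  have hL := h.L_nonneg
  have hM := h.M_nonneg
  have hA := hφ.nonneg
  have hpi := Real.pi_pos
  have hσ1' : 0 < 1 - σ := by linarith
  set B := 2 * A * L * c ^ (σ - 1) with hB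
  set C1 := 4 * A * L ^ σ * L / c ^ 2 with hC1
  set C2 := 2 * (B * ((15 / c) ^ σ / σ)) with hC2
  set C3 := C1 * ((10 / c) ^ (σ - 1) / (1 - σ)) + A * 5 ^ σ * (2 * M / c * Real.pi + 3 / 5) with hC3
  have hB0 : 0 ≤ B := by positivity
  have hC10 : 0 ≤ C1 := by positivity
  refine ⟨2 * C2 + 2 * C3, by positivity, fun δ z w a b hδ hδ0 ha hb hzw hz hw => ?_⟩
  -- Replace `a` by an equivalent parameter at distance at most `π` from `b`.
  obtain ⟨a', haa, hφa, hab'⟩ : ∃ a', γ a' = γ a ∧ φ a' = φ a ∧ |a' - b| ≤ Real.pi := by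
    obtain ⟨n, hn⟩ := exists_abs_sub_zsmul_le a b
    exact ⟨_, h.periodic.sub_zsmul_eq n, hφ.periodic.sub_zsmul_eq n, hn⟩
  have hJ : cauchyDiff γ φ z a = cauchyDiff γ φ z a' := by
    simp only [cauchyDiff, cauchyDiffKernel, hφa]
  rw [hJ]
  rw [← haa] at ha hz
  clear hJ hφa haa
  have hab : |a' - b| ≤ 5 / c * δ := by
    have h1 := h.lower b a' (by linarith)
    have h2 : ‖γ a' - γ b‖ ≤ 5 * δ := by
      have e : γ a' - γ b = (γ a' - z) + (z - w) - (γ b - w) := by ring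
      rw [e]
      refine (norm_sub_le _ _).trans ?_
      have := norm_add_le (γ a' - z) (z - w)
      linarith
    rw [div_mul_eq_mul_div, le_div_iff₀ hc]
    linarith
  set ρ := 10 / c * δ with hρ
  have hρ0 : 0 < ρ := by positivity
  have hρπ : ρ ≤ Real.pi / 2 := by
    rw [hρ, div_mul_eq_mul_div, div_le_iff₀ hc]; linarith
  have h15 : 15 / c * δ = ρ + 5 / c * δ := by rw [hρ]; ring
  have h5ρ : 5 / c * δ = ρ / 2 := by rw [hρ]; ring
  have hintz := intervalIntegrable_cauchyDiffKernel h hφ hσ0 hσ1 ha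
  have hintw := intervalIntegrable_cauchyDiffKernel h hφ hσ0 hσ1 hb
  have hpow : (15 / c * δ) ^ σ = (15 / c) ^ σ * δ ^ σ := Real.mul_rpow (by positivity) hδ.le
  -- `ρ = 10δ/c` is so large that, for `|t - b| ≥ ρ`, the distances from `γ t` to `z`, `w` and
  -- `γ b` are comparable.
  have near : ∀ (z : ℂ) (a : ℝ), (∀ t, ‖γ a - z‖ ≤ ‖γ t - z‖) → |a - b| ≤ 5 / c * δ →
      ‖∫ t in (b - ρ)..(b + ρ), cauchyDiffKernel γ φ z a t‖ ≤ C2 * δ ^ σ := by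
    intro z a ha hab
    have hab2 := abs_le.1 hab
    refine (norm_integral_cauchyDiffKernel_near_le h hφ hσ0 hσ1 ha (R := 15 / c * δ)
      (by linarith) (by linarith) (by linarith) (by linarith)).trans (le_of_eq ?_)
    rw [hpow, hC2]; ring
  have near1 := near z a' ha hab
  have near2 := near w b hb (by simp; positivity)
  set D : ℝ → ℂ := fun t => cauchyDiffKernel γ φ z a' t - cauchyDiffKernel γ φ w b t -
    (φ b - φ a') * ((t - b : ℝ) : ℂ)⁻¹ with hD
  set g : ℝ → ℝ := fun τ => (C1 * δ) * τ ^ (σ - 2) +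
        A * (5 * δ) ^ σ * (2 * M / c + 6 * δ / c * τ ^ (-2 : ℝ)) with hg
  have hgi : IntervalIntegrable g volume ρ Real.pi := by
    refine ((intervalIntegrable_rpow_of_pos _ hρ0 hpi).const_mul _).add ?_
    refine IntervalIntegrable.const_mul ?_ _
    exact (intervalIntegrable_const).add ((intervalIntegrable_rpow_of_pos _ hρ0 hpi).const_mul _)
  have hgle : ∫ τ in ρ..Real.pi, g τ ≤ C3 * δ ^ σ := by
    have i1 := integral_rpow_le (p := σ - 2) (by linarith) hρ0 (v := Real.pi) (by linarith)
    have i2 := integral_rpow_le (p := -2) (by norm_num) hρ0 (v := Real.pi) (by linarith)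
    rw [show σ - 2 + 1 = σ - 1 by ring, show -(σ - 1) = 1 - σ by ring] at i1
    rw [show (-2 : ℝ) + 1 = -1 by ring, Real.rpow_neg_one, neg_neg, div_one] at i2
    have e : ∫ τ in ρ..Real.pi, g τ = (C1 * δ) * (∫ τ in ρ..Real.pi, τ ^ (σ - 2)) +
        A * (5 * δ) ^ σ * (2 * M / c * (Real.pi - ρ) +
          6 * δ / c * ∫ τ in ρ..Real.pi, τ ^ (-2 : ℝ)) := by
      rw [hg, intervalIntegral.integral_add, intervalIntegral.integral_const_mul,
        intervalIntegral.integral_const_mul, intervalIntegral.integral_add,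
        intervalIntegral.integral_const_mul, intervalIntegral.integral_const, smul_eq_mul]
      · ring
      · exact intervalIntegrable_const
      · exact (intervalIntegrable_rpow_of_pos _ hρ0 hpi).const_mul _
      · exact (intervalIntegrable_rpow_of_pos _ hρ0 hpi).const_mul _
      · refine IntervalIntegrable.const_mul ?_ _
        exact (intervalIntegrable_const).add
          ((intervalIntegrable_rpow_of_pos _ hρ0 hpi).const_mul _)
    rw [e]
    calc _ ≤ (C1 * δ) * (ρ ^ (σ - 1) / (1 - σ)) +
          A * (5 * δ) ^ σ * (2 * M / c * Real.pi + 6 * δ / c * ρ⁻¹) := by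
          gcongr
          linarith
      _ = _ := by
          rw [hC3, hρ, Real.mul_rpow (by positivity) hδ.le, Real.mul_rpow (by positivity) hδ.le]
          have : δ ^ σ = δ ^ (σ - 1) * δ := by
            rw [← Real.rpow_add_one hδ.ne']; ring_nf
          rw [this]
          field_simp
          ring
  have hDle : ∀ t, t ≠ b → ρ ≤ |t - b| → |t - b| ≤ Real.pi → ‖D t‖ ≤ g |t - b| := by
    intro t _ h1 h2
    exact norm_cauchyDiffKernel_sub_le h hφ hσ0 hzw hz hw h1 hδ (by linarith)
  have far1 := (norm_integral_left_le (by linarith) hρ0.le hgi hDle).trans hgle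
  have far2 := (norm_integral_right_le (by linarith) hρ0.le hgi hDle).trans hgle
  have hinv : ∀ u v : ℝ, b ∉ uIcc u v →
      IntervalIntegrable (fun t : ℝ => (φ b - φ a') * ((t - b : ℝ) : ℂ)⁻¹) volume u v := by
    intro u v huv
    refine ContinuousOn.intervalIntegrable fun t ht => ?_
    have : ((t - b : ℝ) : ℂ) ≠ 0 := by
      rw [Complex.ofReal_ne_zero, sub_ne_zero]; rintro rfl; exact huv ht
    have hcont : ContinuousAt (fun t : ℝ => ((t - b : ℝ) : ℂ)) t := by fun_prop
    exact (continuousAt_const.mul (hcont.inv₀ this)).continuousWithinAt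
  have hDint : ∀ u v : ℝ, b ∉ uIcc u v → ∫ t in u..v, D t =
      (∫ t in u..v, cauchyDiffKernel γ φ z a' t) - (∫ t in u..v, cauchyDiffKernel γ φ w b t) -
        (φ b - φ a') * ∫ t in u..v, ((t - b : ℝ) : ℂ)⁻¹ := by
    intro u v huv
    rw [hD, intervalIntegral.integral_sub ((hintz u v).sub (hintw u v)) (hinv u v huv),
      intervalIntegral.integral_sub (hintz u v) (hintw u v), intervalIntegral.integral_const_mul]
  rw [hDint _ _ (notMem_uIcc_of_gt (by linarith) (by linarith))] at far1
  rw [hDint _ _ (notMem_uIcc_of_lt (by linarith) (by linarith))] at far2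
  have hcancel := integral_inv_symm_cancel b hρ0 hpi
  rw [cauchyDiff_eq h hφ z a' b, cauchyDiff_eq h hφ w b b]
  have split : ∀ G : ℝ → ℂ, (∀ u v, IntervalIntegrable G volume u v) →
      ∫ t in (b - Real.pi)..(b + Real.pi), G t = (∫ t in (b - Real.pi)..(b - ρ), G t) +
        (∫ t in (b - ρ)..(b + ρ), G t) + ∫ t in (b + ρ)..(b + Real.pi), G t := by
    intro G hG
    rw [intervalIntegral.integral_add_adjacent_intervals (hG _ _) (hG _ _),
      intervalIntegral.integral_add_adjacent_intervals (hG _ _) (hG _ _)]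
  rw [split _ hintz, split _ hintw]
  set z1 := ∫ t in (b - Real.pi)..(b - ρ), cauchyDiffKernel γ φ z a' t
  set z2 := ∫ t in (b - ρ)..(b + ρ), cauchyDiffKernel γ φ z a' t
  set z3 := ∫ t in (b + ρ)..(b + Real.pi), cauchyDiffKernel γ φ z a' t
  set w1 := ∫ t in (b - Real.pi)..(b - ρ), cauchyDiffKernel γ φ w b t
  set w2 := ∫ t in (b - ρ)..(b + ρ), cauchyDiffKernel γ φ w b t
  set w3 := ∫ t in (b + ρ)..(b + Real.pi), cauchyDiffKernel γ φ w b t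
  set k1 := ∫ t in (b - Real.pi)..(b - ρ), ((t - b : ℝ) : ℂ)⁻¹
  set k2 := ∫ t in (b + ρ)..(b + Real.pi), ((t - b : ℝ) : ℂ)⁻¹
  have e : z1 + z2 + z3 - (w1 + w2 + w3) = (z2 - w2) + ((z1 - w1 - (φ b - φ a') * k1) +
      (z3 - w3 - (φ b - φ a') * k2)) := by
    linear_combination (φ b - φ a') * hcancel
  rw [e]
  have n1 := norm_add_le (z2 - w2) ((z1 - w1 - (φ b - φ a') * k1) +
      (z3 - w3 - (φ b - φ a') * k2))
  have n2 := norm_sub_le z2 w2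
  have n3 := norm_add_le (z1 - w1 - (φ b - φ a') * k1) (z3 - w3 - (φ b - φ a') * k2)
  linarith

/-! ### The theorem of Plemelj and Privalov -/

/-- The Cauchy integral of a density given in terms of the parameter. -/
def cauchyIntegral (γ φ : ℝ → ℂ) (z : ℂ) : ℂ :=
  (2 * Real.pi * Complex.I)⁻¹ * ∫ t in (0 : ℝ)..2 * Real.pi, φ t / (γ t - z) * deriv γ t

/-- The winding number of the closed curve `γ` around `z`, as a complex number. -/
def windingNumber (γ : ℝ → ℂ) (z : ℂ) : ℂ :=
  (2 * Real.pi * Complex.I)⁻¹ * ∫ t in (0 : ℝ)..2 * Real.pi, deriv γ t / (γ t - z)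

lemma continuous_div_sub_mul_deriv (h : ChordArc γ c L M) (hφ : Continuous φ) {z : ℂ}
    (hz : z ∉ range γ) : Continuous fun t => φ t / (γ t - z) * deriv γ t := by
  have h1 := h.differentiable.continuous
  exact (hφ.div (h1.sub continuous_const) fun t ht => hz ⟨t, sub_eq_zero.1 ht⟩).mul
    h.continuous_deriv

lemma cauchyIntegral_eq (h : ChordArc γ c L M) (hφ : Continuous φ) {z : ℂ} (hz : z ∉ range γ)
    (a : ℝ) : cauchyIntegral γ φ z =
      (2 * Real.pi * Complex.I)⁻¹ * cauchyDiff γ φ z a + windingNumber γ z * φ a := by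
  have h1 := continuous_div_sub_mul_deriv h hφ hz
  have h2 := continuous_div_sub_mul_deriv h (φ := fun _ => φ a) continuous_const hz
  have e : cauchyDiff γ φ z a = (∫ t in (0 : ℝ)..2 * Real.pi, φ t / (γ t - z) * deriv γ t) -
      φ a * ∫ t in (0 : ℝ)..2 * Real.pi, deriv γ t / (γ t - z) := by
    rw [← intervalIntegral.integral_const_mul, ← intervalIntegral.integral_sub
      (h1.intervalIntegrable _ _)]
    · simp only [cauchyDiff, cauchyDiffKernel]
      congr 1
      ext t
      ring
    · exact (h2.congr fun t => by ring).intervalIntegrable _ _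
  rw [e, cauchyIntegral, windingNumber]
  ring

lemma integral_rpow_add_le {p d v : ℝ} (hp : p < -1) (hd : 0 < d) (hv : 0 ≤ v) :
    ∫ τ in (0 : ℝ)..v, (d + τ) ^ p ≤ d ^ (p + 1) / (-(p + 1)) := by
  rw [intervalIntegral.integral_comp_add_left (fun τ => τ ^ p) d, add_zero]
  exact integral_rpow_le hp hd (by linarith)

/-- The Hölder estimate for the Cauchy integral at two points which are near each other, relative
to the distance from the curve. -/
lemma exists_norm_cauchyIntegral_sub_le_far (h : ChordArc γ c L M) (hφ : HolderDensity γ φ A σ)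
    (hσ0 : 0 < σ) (hσ1 : σ < 1) : ∃ C, 0 ≤ C ∧ ∀ (z w : ℂ) (a : ℝ),
      (∀ t, ‖γ a - z‖ ≤ ‖γ t - z‖) → 0 < ‖z - w‖ → 2 * ‖z - w‖ ≤ ‖γ a - z‖ →
      windingNumber γ z = windingNumber γ w →
      ‖cauchyIntegral γ φ z - cauchyIntegral γ φ w‖ ≤ C * ‖z - w‖ ^ σ := by
  have hc := h.pos
  have hL := h.L_nonneg
  have hA := hφ.nonneg
  have hpi := Real.pi_pos
  have hσ1' : 0 < 1 - σ := by linarith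
  set e := min (1 / 2) (c / 4) with he
  have he0 : 0 < e := lt_min (by norm_num) (by positivity)
  set B := 2 * A * L * 2 ^ σ * e ^ (σ - 2) with hB
  have hB0 : 0 ≤ B := by positivity
  refine ⟨‖(2 * Real.pi * Complex.I : ℂ)⁻¹‖ * (2 * (B / (1 - σ))), by positivity,
    fun z w a ha hδ hd hW => ?_⟩
  set δ := ‖z - w‖ with hδdef
  set d := ‖γ a - z‖ with hddef
  have hd0 : 0 < d := by linarith
  have htw : ∀ t, ‖γ t - z‖ / 2 ≤ ‖γ t - w‖ := by
    intro t
    have h1 := norm_sub_norm_le (γ t - z) (w - z)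
    rw [sub_sub_sub_cancel_right, norm_sub_rev w z] at h1
    linarith [ha t]
  have hz : z ∉ range γ := by
    rintro ⟨t, rfl⟩
    have := ha t
    simp at this
    linarith
  have hw : w ∉ range γ := by
    rintro ⟨t, rfl⟩
    have h1 := htw t
    simp only [sub_self, norm_zero] at h1
    linarith [ha t]
  have hintz := intervalIntegrable_cauchyDiffKernel h hφ hσ0 hσ1 ha
  have hintw : ∀ u v, IntervalIntegrable (cauchyDiffKernel γ φ w a) volume u v := by
    intro u v
    have := continuous_div_sub_mul_deriv h (φ := fun t => φ t - φ a)
      (hφ.continuous.sub continuous_const) hw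
    exact (this.congr fun t => by rw [cauchyDiffKernel]; ring).intervalIntegrable u v
  rw [cauchyIntegral_eq h hφ.continuous hz a, cauchyIntegral_eq h hφ.continuous hw a, hW,
    add_sub_add_right_eq_sub, ← mul_sub, norm_mul,
    mul_assoc ‖(2 * Real.pi * Complex.I : ℂ)⁻¹‖]
  refine mul_le_mul_of_nonneg_left ?_ (norm_nonneg _)
  rw [cauchyDiff_eq h hφ z a a, cauchyDiff_eq h hφ w a a,
    ← intervalIntegral.integral_sub (hintz _ _) (hintw _ _)]
  have hpt : ∀ t, t ≠ a → |t - a| ≤ Real.pi →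
      ‖cauchyDiffKernel γ φ z a t - cauchyDiffKernel γ φ w a t‖ ≤
        B * δ * (d + |t - a|) ^ (σ - 2) := by
    intro t _ ht
    have h1 : ‖γ t - γ a‖ ≤ 2 * ‖γ t - z‖ := norm_sub_nearest_le ha t
    have h2 := h.lower a t (by linarith)
    have h3 := ha t
    have hz0 : 0 < ‖γ t - z‖ := hd0.trans_le h3
    have hw0 : 0 < ‖γ t - w‖ := lt_of_lt_of_le (by positivity) (htw t)
    have h4 : e * (d + |t - a|) ≤ ‖γ t - z‖ := by
      have i1 : e * d ≤ 1 / 2 * d := by gcongr; exact min_le_left _ _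
      have i2 : e * |t - a| ≤ c / 4 * |t - a| := by gcongr; exact min_le_right _ _
      linarith
    have key : cauchyDiffKernel γ φ z a t - cauchyDiffKernel γ φ w a t =
        (φ t - φ a) * deriv γ t * (z - w) / ((γ t - z) * (γ t - w)) := by
      have := norm_pos_iff.1 hz0
      have := norm_pos_iff.1 hw0
      simp only [cauchyDiffKernel]
      field_simp
      ring
    rw [key, norm_div, norm_mul, norm_mul, norm_mul]
    have i1 : ‖φ t - φ a‖ ≤ A * (2 * ‖γ t - z‖) ^ σ := (hφ.holder a t).trans (by gcongr)
    calc _ ≤ A * (2 * ‖γ t - z‖) ^ σ * L * δ / (‖γ t - z‖ * (‖γ t - z‖ / 2)) := by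
          have := h.deriv_le t
          have := htw t
          gcongr
      _ = 2 * A * L * 2 ^ σ * δ * ‖γ t - z‖ ^ (σ - 2) := by
          rw [Real.mul_rpow (by norm_num) hz0.le, Real.rpow_sub hz0, Real.rpow_two]
          field_simp
      _ ≤ 2 * A * L * 2 ^ σ * δ * (e * (d + |t - a|)) ^ (σ - 2) := by
          refine mul_le_mul_of_nonneg_left ?_ (by positivity)
          exact Real.rpow_le_rpow_of_nonpos (by positivity) h4 (by linarith)
      _ = _ := by
          rw [Real.mul_rpow he0.le (by positivity), hB]; ring
  have hgi : IntervalIntegrable (fun τ => B * δ * (d + τ) ^ (σ - 2)) volume 0 Real.pi := by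
    refine IntervalIntegrable.const_mul ?_ _
    refine ContinuousOn.intervalIntegrable fun τ hτ => ?_
    rw [uIcc_of_le hpi.le] at hτ
    have : d + τ ≠ 0 := by linarith [hτ.1]
    exact (ContinuousAt.rpow_const (by fun_prop) (Or.inl this)).continuousWithinAt
  refine (norm_integral_symm_le hpi.le hgi ((hintz _ _).sub (hintw _ _)) hpt).trans ?_
  rw [intervalIntegral.integral_const_mul]
  have i1 := integral_rpow_add_le (p := σ - 2) (by linarith) hd0 hpi.le
  rw [show σ - 2 + 1 = σ - 1 by ring, show -(σ - 1) = 1 - σ by ring] at i1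
  have i2 : d ^ (σ - 1) ≤ δ ^ (σ - 1) :=
    Real.rpow_le_rpow_of_nonpos hδ (by linarith) (by linarith)
  have i3 : δ ^ σ = δ ^ (σ - 1) * δ := by
    rw [← Real.rpow_add_one hδ.ne']; ring_nf
  calc _ ≤ 2 * (B * δ * (δ ^ (σ - 1) / (1 - σ))) := by
        gcongr
        exact i1.trans (by gcongr)
    _ = _ := by rw [i3]; ring

/-- A parameter of a point of the curve nearest to `z`. -/
def nearestParam (γ : ℝ → ℂ) (z : ℂ) : ℝ :=
  Classical.epsilon fun a => ∀ t, ‖γ a - z‖ ≤ ‖γ t - z‖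

lemma nearestParam_spec (h : ChordArc γ c L M) (z : ℂ) :
    ∀ t, ‖γ (nearestParam γ z) - z‖ ≤ ‖γ t - z‖ :=
  Classical.epsilon_spec (exists_nearest h.differentiable.continuous h.periodic z)

lemma apply_nearestParam (h : ChordArc γ c L M) (t : ℝ) : γ (nearestParam γ (γ t)) = γ t := by
  have := nearestParam_spec h (γ t) t
  rw [sub_self, norm_zero] at this
  exact sub_eq_zero.1 (norm_le_zero_iff.1 this)

/-- The Cauchy integral of `φ`, extended to the curve: on a side of the curve where the winding
number is `k`, this is the extension of the Cauchy integral by its boundary values. -/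
def cauchyExtension (γ φ : ℝ → ℂ) (k z : ℂ) : ℂ :=
  (2 * Real.pi * Complex.I)⁻¹ * cauchyDiff γ φ z (nearestParam γ z) + k * φ (nearestParam γ z)

lemma cauchyExtension_eq_cauchyIntegral (h : ChordArc γ c L M) (hφ : Continuous φ) {z : ℂ}
    (hz : z ∉ range γ) : cauchyExtension γ φ (windingNumber γ z) z = cauchyIntegral γ φ z :=
  (cauchyIntegral_eq h hφ hz _).symm

/-- The jump of the Cauchy integral across the curve. -/
lemma cauchyExtension_one_sub_zero (h : ChordArc γ c L M) (hφ : HolderDensity γ φ A σ)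
    (hσ0 : 0 < σ) (t : ℝ) : cauchyExtension γ φ 1 (γ t) - cauchyExtension γ φ 0 (γ t) = φ t := by
  have h1 := hφ.holder t (nearestParam γ (γ t))
  rw [apply_nearestParam h, sub_self, norm_zero, Real.zero_rpow hσ0.ne', mul_zero] at h1
  have h2 := sub_eq_zero.1 (norm_le_zero_iff.1 h1)
  simp [cauchyExtension, h2]

/-- **Privalov's theorem**: on a set where the winding number takes only the value `k`, the
extended Cauchy integral of a Hölder continuous density is Hölder continuous. -/
theorem exists_norm_cauchyExtension_sub_le (h : ChordArc γ c L M) (hφ : HolderDensity γ φ A σ)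
    (hσ0 : 0 < σ) (hσ1 : σ < 1) (k : ℂ) : ∃ C, 0 ≤ C ∧ ∀ S : Set ℂ,
      (∀ z ∈ S, z ∉ range γ → windingNumber γ z = k) → ∀ z ∈ S, ∀ w ∈ S,
      ‖cauchyExtension γ φ k z - cauchyExtension γ φ k w‖ ≤ C * ‖z - w‖ ^ σ := by
  obtain ⟨C1, hC1, H1⟩ := exists_norm_cauchyIntegral_sub_le_far h hφ hσ0 hσ1
  obtain ⟨C2, hC2, H2⟩ := exists_norm_cauchyDiff_sub_le_near h hφ hσ0 hσ1
  obtain ⟨N, hN⟩ := exists_norm_le_of_periodic hφ.continuous hφ.periodic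
  have hc := h.pos
  have hL := h.L_nonneg
  have hA := hφ.nonneg
  have hpi := Real.pi_pos
  have hN0 : 0 ≤ N := (norm_nonneg _).trans (hN 0)
  set q := ‖(2 * Real.pi * Complex.I : ℂ)⁻¹‖ with hq
  set δ₀ := c * Real.pi / 20 with hδ₀
  have hδ₀0 : 0 < δ₀ := by positivity
  set P := q * (2 * ((2 * A * L * c ^ (σ - 1)) * (Real.pi ^ σ / σ))) + ‖k‖ * N with hP
  have hP0 : 0 ≤ P := by positivity
  have hbd : ∀ z, ‖cauchyExtension γ φ k z‖ ≤ P := by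
    intro z
    refine (norm_add_le _ _).trans ?_
    rw [norm_mul, norm_mul]
    exact add_le_add (mul_le_mul_of_nonneg_left
      (norm_cauchyDiff_le h hφ hσ0 hσ1 (nearestParam_spec h z)) (norm_nonneg _))
      (mul_le_mul_of_nonneg_left (hN _) (norm_nonneg _))
  set Q := q * C2 + ‖k‖ * (A * 5 ^ σ) with hQ
  have hQ0 : 0 ≤ Q := by positivity
  refine ⟨2 * P / δ₀ ^ σ + C1 + Q, by positivity, fun S hS z hz w hw => ?_⟩
  have main : ∀ z ∈ S, ∀ w ∈ S, 0 < ‖z - w‖ → 2 * ‖z - w‖ ≤ ‖γ (nearestParam γ z) - z‖ →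
      ‖cauchyExtension γ φ k z - cauchyExtension γ φ k w‖ ≤ C1 * ‖z - w‖ ^ σ := by
    intro z hz w hw h0 h2
    have hsp := nearestParam_spec h z
    have hz' : z ∉ range γ := by
      rintro ⟨t, rfl⟩
      have := hsp t
      rw [sub_self, norm_zero] at this
      linarith
    have hw' : w ∉ range γ := by
      rintro ⟨t, rfl⟩
      have := hsp t
      rw [norm_sub_rev (γ t)] at this
      linarith
    have e1 := hS z hz hz'
    have e2 := hS w hw hw'
    have e3 := cauchyExtension_eq_cauchyIntegral h hφ.continuous hz'
    have e4 := cauchyExtension_eq_cauchyIntegral h hφ.continuous hw'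
    rw [e1] at e3
    rw [e2] at e4
    rw [e3, e4]
    exact H1 z w _ hsp h0 h2 (e1.trans e2.symm)
  rcases eq_or_ne z w with rfl | hne
  · rw [sub_self, norm_zero]; positivity
  have hδ : 0 < ‖z - w‖ := norm_pos_iff.2 (sub_ne_zero.2 hne)
  have hδσ : 0 < ‖z - w‖ ^ σ := Real.rpow_pos_of_pos hδ σ
  have t1 : 0 ≤ 2 * P / δ₀ ^ σ * ‖z - w‖ ^ σ := by positivity
  have t2 : 0 ≤ C1 * ‖z - w‖ ^ σ := by positivity
  have t3 : 0 ≤ Q * ‖z - w‖ ^ σ := by positivity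
  rw [add_mul, add_mul]
  -- For distant points boundedness suffices; otherwise the distances of `z` and `w` from the curve,
  -- compared with `‖z - w‖`, decide which estimate applies.
  rcases le_total δ₀ ‖z - w‖ with hbig | hsmall
  · have i1 : 2 * P ≤ 2 * P / δ₀ ^ σ * ‖z - w‖ ^ σ := by
      rw [div_mul_eq_mul_div, le_div_iff₀ (by positivity)]
      gcongr
    have := norm_sub_le (cauchyExtension γ φ k z) (cauchyExtension γ φ k w)
    linarith [hbd z, hbd w]
  rcases le_total (2 * ‖z - w‖) ‖γ (nearestParam γ z) - z‖ with hdz | hdz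
  · linarith [main z hz w hw hδ hdz]
  rcases le_total (2 * ‖z - w‖) ‖γ (nearestParam γ w) - w‖ with hdw | hdw
  · have := main w hw z hz (by rwa [norm_sub_rev]) (by rwa [norm_sub_rev w z])
    rw [norm_sub_rev, norm_sub_rev w z] at this
    linarith
  have := H2 _ z w _ _ hδ hsmall (nearestParam_spec h z) (nearestParam_spec h w) le_rfl hdz hdw
  have hφd : ‖φ (nearestParam γ z) - φ (nearestParam γ w)‖ ≤ A * 5 ^ σ * ‖z - w‖ ^ σ := by
    refine (hφ.holder _ _).trans ?_
    rw [mul_assoc, ← Real.mul_rpow (by norm_num) hδ.le]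
    gcongr
    have e : γ (nearestParam γ z) - γ (nearestParam γ w) =
        (γ (nearestParam γ z) - z) + (z - w) - (γ (nearestParam γ w) - w) := by ring
    rw [e]
    refine (norm_sub_le _ _).trans ?_
    have := norm_add_le (γ (nearestParam γ z) - z) (z - w)
    linarith
  have hfin : ‖cauchyExtension γ φ k z - cauchyExtension γ φ k w‖ ≤ Q * ‖z - w‖ ^ σ := by
    rw [cauchyExtension, cauchyExtension, add_sub_add_comm, ← mul_sub, ← mul_sub]
    refine (norm_add_le _ _).trans ?_
    rw [norm_mul, norm_mul, hQ, add_mul, mul_assoc q, mul_assoc ‖k‖]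
    exact add_le_add (mul_le_mul_of_nonneg_left this (norm_nonneg _))
      (mul_le_mul_of_nonneg_left hφd (norm_nonneg _))
  linarith

/-! ### Removability of analytic curves -/

/-- The real line is removable for continuous functions that are holomorphic off it, by Morera's
theorem: a rectangle meeting the line is cut along it. -/
theorem differentiableOn_of_continuousOn_of_im_ne_zero {f : ℂ → ℂ} {U : Set ℂ} (hU : IsOpen U)
    (hc : ContinuousOn f U) (hd : ∀ z ∈ U, z.im ≠ 0 → DifferentiableAt ℂ f z) :
    DifferentiableOn ℂ f U := by
  refine (Complex.isConservativeOn_and_continuousOn_iff_isDifferentiableOn hU).1 ⟨?_, hc⟩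
  intro z w hzw
  rw [← add_eq_zero_iff_eq_neg, Complex.wedgeIntegral_add_wedgeIntegral_eq]
  have hsub : ∀ p q : ℝ, ∀ y₁ y₂ : ℝ, p ∈ uIcc z.re w.re → q ∈ uIcc z.re w.re →
      y₁ ∈ uIcc z.im w.im → y₂ ∈ uIcc z.im w.im → uIcc p q ×ℂ uIcc y₁ y₂ ⊆ U := by
    intro p q y₁ y₂ hp hq h1 h2
    refine Subset.trans ?_ hzw
    exact Complex.reProdIm_subset_iff.2
      (prod_mono (uIcc_subset_uIcc hp hq) (uIcc_subset_uIcc h1 h2))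
  have hIoo : ∀ p q : ℝ, Ioo (min p q) (max p q) ⊆ uIcc p q := fun p q => Ioo_subset_Icc_self
  by_cases h0 : (0 : ℝ) ∈ uIcc z.im w.im
  · have key : ∀ y₁ y₂ : ℝ, y₁ ∈ uIcc z.im w.im → y₂ ∈ uIcc z.im w.im → (y₁ = 0 ∨ y₂ = 0) →
        (∫ x : ℝ in z.re..w.re, f (x + y₁ * Complex.I)) -
        (∫ x : ℝ in z.re..w.re, f (x + y₂ * Complex.I)) +
        Complex.I • (∫ y : ℝ in y₁..y₂, f (w.re + y * Complex.I)) -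
        Complex.I • (∫ y : ℝ in y₁..y₂, f (z.re + y * Complex.I)) = 0 := by
      intro y₁ y₂ h1 h2 h12
      refine Complex.integral_boundary_rect_eq_zero_of_continuousOn_of_differentiableOn f
        ⟨z.re, y₁⟩ ⟨w.re, y₂⟩ (hc.mono (hsub _ _ _ _ left_mem_uIcc right_mem_uIcc h1 h2)) ?_
      intro x hx
      refine (hd x (hsub _ _ _ _ left_mem_uIcc right_mem_uIcc h1 h2
        ⟨hIoo _ _ hx.1, hIoo _ _ hx.2⟩) fun hx0 => ?_).differentiableWithinAt
      have := hx.2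
      simp only [mem_preimage, hx0, mem_Ioo, min_lt_iff, lt_max_iff] at this
      rcases h12 with rfl | rfl <;> grind
    have k1 := key z.im 0 left_mem_uIcc h0 (Or.inr rfl)
    have k2 := key 0 w.im h0 right_mem_uIcc (Or.inl rfl)
    have hint : ∀ p y₁ y₂ : ℝ, p ∈ uIcc z.re w.re → y₁ ∈ uIcc z.im w.im → y₂ ∈ uIcc z.im w.im →
        IntervalIntegrable (fun y : ℝ => f (p + y * Complex.I)) volume y₁ y₂ := by
      intro p y₁ y₂ hp h1 h2
      refine ContinuousOn.intervalIntegrable ?_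
      refine (hc.mono (hsub p p y₁ y₂ hp hp h1 h2)).comp (by fun_prop) fun y hy => ?_
      simp [Complex.mem_reProdIm, hy]
    rw [← intervalIntegral.integral_add_adjacent_intervals
        (hint w.re z.im 0 right_mem_uIcc left_mem_uIcc h0)
        (hint w.re 0 w.im right_mem_uIcc h0 right_mem_uIcc),
      ← intervalIntegral.integral_add_adjacent_intervals
        (hint z.re z.im 0 left_mem_uIcc left_mem_uIcc h0)
        (hint z.re 0 w.im left_mem_uIcc h0 right_mem_uIcc)]
    simp only [smul_eq_mul] at *
    linear_combination k1 + k2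
  · refine Complex.integral_boundary_rect_eq_zero_of_continuousOn_of_differentiableOn f z w
      (hc.mono hzw) fun x hx => ?_
    have hx' : x ∈ uIcc z.re w.re ×ℂ uIcc z.im w.im := ⟨hIoo _ _ hx.1, hIoo _ _ hx.2⟩
    refine (hd x (hzw hx') fun hx0 => h0 ?_).differentiableWithinAt
    rw [← hx0]
    exact hx'.2

/-- A real-analytic map of a real variable extends locally to a holomorphic one. -/
lemma exists_analyticAt_extension {γ : ℝ → ℂ} {a : ℝ} (h : AnalyticAt ℝ γ a) :
    ∃ G : ℂ → ℂ, AnalyticAt ℂ G a ∧ ∀ᶠ t : ℝ in 𝓝 a, G t = γ t := by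
  obtain ⟨p, hp⟩ := h
  set q : FormalMultilinearSeries ℂ ℂ ℂ :=
    fun n => ContinuousMultilinearMap.mkPiRing ℂ (Fin n) (p.coeff n) with hq
  have hqp : ∀ n, ‖q n‖ = ‖p n‖ := fun n => by
    rw [hq, ContinuousMultilinearMap.norm_mkPiRing, p.norm_apply_eq_norm_coef]
  have hrad : 0 < q.radius := by
    obtain ⟨r, hr0, hr⟩ := ENNReal.lt_iff_exists_nnreal_btwn.1 hp.radius_pos
    refine hr0.trans_le (q.le_radius_of_summable_norm ?_)
    simpa only [hqp] using p.summable_norm_mul_pow hr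
  have hG := q.hasFPowerSeriesOnBall hrad
  refine ⟨fun w => q.sum (w - a), ?_, ?_⟩
  · have := hG.analyticAt
    refine AnalyticAt.comp (g := q.sum) (f := fun w : ℂ => w - a) ?_ (by fun_prop)
    simpa using this
  · filter_upwards [hasFPowerSeriesAt_iff'.1 hp] with t ht
    rw [← ht.tsum_eq, FormalMultilinearSeries.sum]
    congr 1
    ext n
    simp [hq]

lemma exists_hasStrictDerivAt_extension {γ : ℝ → ℂ} {a : ℝ} (h : AnalyticAt ℝ γ a) :
    ∃ G : ℂ → ℂ, AnalyticAt ℂ G a ∧ HasStrictDerivAt G (deriv γ a) a ∧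
      ∀ᶠ t : ℝ in 𝓝 a, G t = γ t := by
  obtain ⟨G, hG, hGγ⟩ := exists_analyticAt_extension h
  refine ⟨G, hG, ?_, hGγ⟩
  have h1 := hG.hasStrictDerivAt
  have h2 : HasDerivAt γ (deriv G a) a := h1.hasDerivAt.comp_ofReal.congr_of_eventuallyEq
    (hGγ.mono fun t ht => ht.symm)
  rwa [h2.deriv]

/-- **Painlevé's theorem** for an analytic Jordan curve: continuous functions that are holomorphic
off the curve are entire. -/
theorem IsAnalyticJordanCurve.differentiable_of_continuous {γ : ℝ → ℂ}
    (h : IsAnalyticJordanCurve γ) {f : ℂ → ℂ} (hf : Continuous f)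
    (hd : ∀ z ∉ range γ, DifferentiableAt ℂ f z) : Differentiable ℂ f := by
  intro z
  by_cases hz : z ∈ range γ
  swap
  · exact hd z hz
  obtain ⟨a, rfl⟩ := hz
  obtain ⟨c, L, M, hγ⟩ := h.exists_chordArc
  have hc := hγ.pos
  obtain ⟨G, hGan, hG, hGγ⟩ := exists_hasStrictDerivAt_extension (h.analytic a (mem_univ a))
  have hGa : G a = γ a := hGγ.self_of_nhds
  have hne := h.deriv_ne_zero a
  set inv := hG.localInverse G (deriv γ a) a hne with hinv
  have hleft : ∀ᶠ w in 𝓝 (a : ℂ), inv (G w) = w := hG.eventually_left_inverse hne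
  have hright : ∀ᶠ x in 𝓝 (G a), G (inv x) = x := hG.eventually_right_inverse hne
  -- Since `G` is locally injective and `γ` satisfies the chord-arc inequality, `G` maps only real
  -- points near `a` to the curve.
  have hoff : ∀ᶠ w : ℂ in 𝓝 (a : ℂ), w.im ≠ 0 → G w ∉ range γ := by
    obtain ⟨ε₁, hε₁, h1⟩ := Metric.eventually_nhds_iff.1 hleft
    obtain ⟨ε₂, hε₂, h2⟩ := Metric.eventually_nhds_iff.1 hGγ
    set ε := min ε₁ ε₂
    have hε : 0 < ε := lt_min hε₁ hε₂
    have hcont : ∀ᶠ w in 𝓝 (a : ℂ), dist (G w) (G a) < c * ε :=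
      hGan.continuousAt.eventually (Metric.ball_mem_nhds _ (by positivity))
    filter_upwards [hleft, hcont] with w hw1 hw2 hw3
    rintro ⟨t', ht'⟩
    obtain ⟨t, ht, hta⟩ : ∃ t, γ t = γ t' ∧ |t - a| ≤ Real.pi := by
      obtain ⟨n, hn⟩ := exists_abs_sub_zsmul_le t' a
      exact ⟨_, hγ.periodic.sub_zsmul_eq n, hn⟩
    have h3 := hγ.lower a t (by linarith [Real.pi_pos])
    rw [dist_eq_norm, hGa, ← ht', ← ht] at hw2
    have h4 : |t - a| < ε := lt_of_mul_lt_mul_left (h3.trans_lt hw2) hc.le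
    have h5 : G t = γ t := h2 (by rw [Real.dist_eq]; exact h4.trans_le (min_le_right _ _))
    have h6 : inv (G t) = t := h1 (by
      rw [dist_eq_norm, ← Complex.ofReal_sub, Complex.norm_real]
      exact h4.trans_le (min_le_left _ _))
    rw [h5, ht, ht', hw1] at h6
    rw [h6] at hw3
    exact hw3 (Complex.ofReal_im t)
  have hdiff : ∀ᶠ w in 𝓝 (a : ℂ), DifferentiableAt ℂ G w :=
    hGan.eventually_analyticAt.mono fun w hw => hw.differentiableAt
  obtain ⟨U, hU, hUo, haU⟩ := eventually_nhds_iff.1 (hoff.and hdiff)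
  have hk : DifferentiableOn ℂ (f ∘ G) U := by
    refine differentiableOn_of_continuousOn_of_im_ne_zero hUo ?_ ?_
    · exact hf.comp_continuousOn fun w hw => (hU w hw).2.continuousAt.continuousWithinAt
    · exact fun w hw hw0 => (hd _ ((hU w hw).1 hw0)).comp w (hU w hw).2
  have hka : DifferentiableAt ℂ (f ∘ G) a := hk.differentiableAt (hUo.mem_nhds haU)
  have hinva : inv (G a) = a := hleft.self_of_nhds
  have hinvd : DifferentiableAt ℂ inv (G a) :=
    (hG.to_localInverse hne).hasDerivAt.differentiableAt
  rw [← hinva] at hka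
  have := hka.comp (G a) hinvd
  rw [← hGa]
  refine this.congr_of_eventuallyEq ?_
  filter_upwards [hright] with x hx
  simp [hx]

theorem IsAnalyticJordanCurve.eq_zero_of_tendsto_zero {γ : ℝ → ℂ}
    (h : IsAnalyticJordanCurve γ) {f : ℂ → ℂ} (hf : Continuous f)
    (hd : ∀ z ∉ range γ, DifferentiableAt ℂ f z) (h0 : Tendsto f (cocompact ℂ) (𝓝 0)) (z : ℂ) :
    f z = 0 :=
  (h.differentiable_of_continuous hf hd).apply_eq_of_tendsto_cocompact z h0

/-! ### Derivative and decay of Cauchy integrals -/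

lemma ChordArc.isCompact_range (h : ChordArc γ c L M) : IsCompact (range γ) :=
  isCompact_range_of_periodic h.differentiable.continuous h.periodic

lemma hasDerivAt_cauchyIntegral (h : ChordArc γ c L M) (hφ : Continuous φ) {z : ℂ}
    (hz : z ∉ range γ) : HasDerivAt (cauchyIntegral γ φ) ((2 * Real.pi * Complex.I)⁻¹ *
      ∫ t in (0 : ℝ)..2 * Real.pi, φ t / (γ t - z) ^ 2 * deriv γ t) z := by
  obtain ⟨r, hr, hball⟩ := Metric.isOpen_iff.1 h.isCompact_range.isClosed.isOpen_compl z hz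
  have hr2 : 0 < r / 2 := by positivity
  have hfar : ∀ w ∈ Metric.ball z (r / 2), ∀ t, r / 2 ≤ ‖γ t - w‖ := by
    intro w hw t
    have h1 : r ≤ dist (γ t) z := by
      by_contra! hlt
      exact hball (Metric.mem_ball.2 hlt) (mem_range_self t)
    rw [← dist_eq_norm]
    have := dist_triangle (γ t) w z
    rw [Metric.mem_ball] at hw
    linarith
  have hoff : ∀ w ∈ Metric.ball z (r / 2), w ∉ range γ := by
    rintro w hw ⟨t, rfl⟩
    have := hfar _ hw t
    rw [sub_self, norm_zero] at this
    linarith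
  have hcont := h.differentiable.continuous
  have hcd := h.continuous_deriv
  have hzb : z ∈ Metric.ball z (r / 2) := Metric.mem_ball_self hr2
  refine HasDerivAt.const_mul _ ?_
  refine (intervalIntegral.hasDerivAt_integral_of_dominated_loc_of_deriv_le
    (F := fun w t => φ t / (γ t - w) * deriv γ t)
    (F' := fun w t => φ t / (γ t - w) ^ 2 * deriv γ t)
    (bound := fun t => ‖φ t‖ / (r / 2) ^ 2 * ‖deriv γ t‖)
    (Metric.ball_mem_nhds z hr2) ?_ ?_ ?_ ?_ ?_ ?_).2
  · filter_upwards [Metric.ball_mem_nhds z hr2] with w hw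
    exact (continuous_div_sub_mul_deriv h hφ (hoff w hw)).aestronglyMeasurable
  · exact (continuous_div_sub_mul_deriv h hφ hz).intervalIntegrable _ _
  · refine Continuous.aestronglyMeasurable ?_
    refine (hφ.div ((hcont.sub continuous_const).pow 2) fun t ht => hz ⟨t, ?_⟩).mul hcd
    exact sub_eq_zero.1 (pow_eq_zero_iff (two_ne_zero)|>.1 ht)
  · refine ae_of_all _ fun t _ w hw => ?_
    rw [norm_mul, norm_div, norm_pow]
    have := hfar w hw t
    gcongr
  · refine Continuous.intervalIntegrable ?_ _ _
    fun_prop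
  · refine ae_of_all _ fun t _ w hw => ?_
    have hne : γ t - w ≠ 0 := fun h0 => hoff w hw ⟨t, sub_eq_zero.1 h0⟩
    have h1 : HasDerivAt (fun w => γ t - w) (-1) w := (hasDerivAt_id w).const_sub (γ t)
    have h2 := ((hasDerivAt_const w (φ t)).fun_div h1 hne).mul_const (deriv γ t)
    simpa using h2

lemma tendsto_cauchyIntegral_cocompact (h : ChordArc γ c L M) (hφ : Continuous φ)
    (hp : Function.Periodic φ (2 * Real.pi)) :
    Tendsto (cauchyIntegral γ φ) (cocompact ℂ) (𝓝 0) := by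
  obtain ⟨R, hR⟩ := exists_norm_le_of_periodic h.differentiable.continuous h.periodic
  obtain ⟨N, hN⟩ := exists_norm_le_of_periodic hφ hp
  have hL := h.L_nonneg
  have hN0 : 0 ≤ N := (norm_nonneg _).trans (hN 0)
  have hlim : Tendsto (fun z : ℂ => ‖z‖ - R) (cocompact ℂ) atTop :=
    tendsto_atTop_add_const_right _ _ tendsto_norm_cocompact_atTop
  have hlim2 : Tendsto (fun z : ℂ => ‖(2 * Real.pi * Complex.I : ℂ)⁻¹‖ *
      (N * (‖z‖ - R)⁻¹ * L * |2 * Real.pi - 0|)) (cocompact ℂ) (𝓝 0) := by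
    have := hlim.inv_tendsto_atTop
    have h1 := (((this.const_mul N).mul_const L).mul_const |2 * Real.pi - 0|).const_mul
      ‖(2 * Real.pi * Complex.I : ℂ)⁻¹‖
    simpa using h1
  refine squeeze_zero_norm' ?_ hlim2
  filter_upwards [hlim.eventually_gt_atTop 0] with z hz
  rw [cauchyIntegral, norm_mul]
  refine mul_le_mul_of_nonneg_left ?_ (norm_nonneg _)
  refine intervalIntegral.norm_integral_le_of_norm_le_const fun t _ => ?_
  have h1 : ‖z‖ - R ≤ ‖γ t - z‖ := by
    have := norm_sub_norm_le z (γ t)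
    rw [norm_sub_rev] at this
    linarith [hR t]
  rw [norm_mul, norm_div, div_eq_mul_inv]
  have := hN t
  have := h.deriv_le t
  gcongr

lemma windingNumber_eq_cauchyIntegral (γ : ℝ → ℂ) :
    windingNumber γ = cauchyIntegral γ fun _ => 1 := by
  ext z
  simp only [windingNumber, cauchyIntegral]
  congr 2
  ext t
  ring

/-- The winding number is locally constant: its derivative is the integral of the derivative of a
periodic function. -/
lemma hasDerivAt_windingNumber (h : ChordArc γ c L M) {z : ℂ} (hz : z ∉ range γ) :
    HasDerivAt (windingNumber γ) 0 z := by
  have h1 := hasDerivAt_cauchyIntegral h (φ := fun _ => 1) continuous_const hz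
  rw [← windingNumber_eq_cauchyIntegral] at h1
  have h2 : ∫ t in (0 : ℝ)..2 * Real.pi, 1 / (γ t - z) ^ 2 * deriv γ t = 0 := by
    have hne : ∀ t, γ t - z ≠ 0 := fun t ht => hz ⟨t, sub_eq_zero.1 ht⟩
    have hd : ∀ t, HasDerivAt (fun t => -(γ t - z)⁻¹) (1 / (γ t - z) ^ 2 * deriv γ t) t := by
      intro t
      have := (((h.differentiable t).hasDerivAt.sub_const z).fun_inv (hne t)).fun_neg
      exact this.congr_deriv (by ring)
    have hc := h.differentiable.continuous
    have hcd := h.continuous_deriv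
    rw [intervalIntegral.integral_eq_sub_of_hasDerivAt (fun t _ => hd t)]
    · have := h.periodic 0
      rw [zero_add] at this
      rw [this, sub_self]
    · refine Continuous.intervalIntegrable ?_ _ _
      exact (continuous_const.div ((hc.sub continuous_const).pow 2)
        fun t => pow_ne_zero 2 (hne t)).mul hcd
  rwa [h2, mul_zero] at h1

/-! ### The two sides of the curve -/

/-- The one-sided collar of the curve swept out by the normal displacements `s ∈ I`. -/
def collar (γ : ℝ → ℂ) (I : Set ℝ) : Set ℂ :=
  (fun p : ℝ × ℝ => γ p.1 + p.2 * Complex.I * deriv γ p.1) '' (univ ×ˢ I)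

lemma ChordArc.isPreconnected_collar (h : ChordArc γ c L M) {I : Set ℝ} (hI : Convex ℝ I) :
    IsPreconnected (collar γ I) := by
  refine (convex_univ.prod hI).isPreconnected.image _ (Continuous.continuousOn ?_)
  have := h.differentiable.continuous
  have := h.continuous_deriv
  fun_prop

lemma ChordArc.normal_notMem_range (h : ChordArc γ c L M) (t : ℝ) {s : ℝ} (hs : s ≠ 0)
    (hsε : M * L * |s| < c ^ 2) : γ t + s * Complex.I * deriv γ t ∉ range γ := by
  -- If the point is `γ t'`, then by the Taylor bound its tangential offset `t' - t` and its normal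
  -- offset `s` are of second order in `t' - t`, while `|t' - t|` is at most `L |s| / c`.
  rintro ⟨t₀, ht₀⟩
  have hc := h.pos
  have hM := h.M_nonneg
  have hL := h.L_nonneg
  obtain ⟨t', ht', hta⟩ : ∃ t', γ t' = γ t₀ ∧ |t' - t| ≤ Real.pi := by
    obtain ⟨n, hn⟩ := exists_abs_sub_zsmul_le t₀ t
    exact ⟨_, h.periodic.sub_zsmul_eq n, hn⟩
  have h1 := h.lower t t' (by linarith [Real.pi_pos])
  have h2 : γ t' - γ t = s * Complex.I * deriv γ t := by rw [ht', ht₀]; ring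
  have h3 := h.taylor t t'
  rw [h2, ← sub_mul, norm_mul] at h3
  rw [h2, norm_mul, norm_mul, Complex.norm_I, mul_one, Complex.norm_real, Real.norm_eq_abs] at h1
  have h4 : |s| * ‖deriv γ t‖ ≤ |s| * L := by gcongr; exact h.deriv_le t
  set e : ℂ := s * Complex.I - ((t' - t : ℝ) : ℂ) with he
  have hre : |t' - t| ≤ ‖e‖ := by
    have := Complex.abs_re_le_norm e
    rw [he] at this ⊢
    simpa [abs_sub_comm] using this
  have him : |s| ≤ ‖e‖ := by
    have := Complex.abs_im_le_norm e
    rw [he] at this ⊢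
    simpa using this
  have h5 : ‖e‖ * c ≤ M * |t' - t| ^ 2 :=
    (mul_le_mul_of_nonneg_left (h.le_deriv t) (norm_nonneg _)).trans h3
  have hs0 : 0 < |s| := abs_pos.2 hs
  rcases eq_or_lt_of_le (abs_nonneg (t' - t)) with h0 | h0
  · rw [← h0] at h5
    have : 0 < ‖e‖ * c := mul_pos (hs0.trans_le him) hc
    norm_num at h5
    linarith
  · have h6 : |t' - t| * c ≤ |t' - t| * (M * |t' - t|) := by
      calc |t' - t| * c ≤ ‖e‖ * c := by gcongr
        _ ≤ M * |t' - t| ^ 2 := h5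
        _ = _ := by ring
    have h7 : c ≤ M * |t' - t| := le_of_mul_le_mul_left h6 h0
    have h8 : c * c ≤ M * (L * |s|) := by
      calc c * c ≤ c * (M * |t' - t|) := by gcongr
        _ = M * (c * |t' - t|) := by ring
        _ ≤ M * (L * |s|) := mul_le_mul_of_nonneg_left (by linarith) hM
    nlinarith

/-- The segment from a point to a nearest point of the curve is normal to the curve. -/
lemma ChordArc.exists_eq_normal (h : ChordArc γ c L M) {z : ℂ} {a : ℝ}
    (ha : ∀ t, ‖γ a - z‖ ≤ ‖γ t - z‖) :
    ∃ s : ℝ, z = γ a + s * Complex.I * deriv γ a ∧ c * |s| ≤ ‖γ a - z‖ := by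
  have hv : deriv γ a ≠ 0 := norm_pos_iff.1 (h.pos.trans_le (h.le_deriv a))
  have h1 : HasDerivAt (fun t => ‖γ t - z‖ ^ 2) (2 * inner ℝ (γ a - z) (deriv γ a)) a :=
    ((h.differentiable a).hasDerivAt.sub_const z).norm_sq
  have h2 : IsLocalMin (fun t => ‖γ t - z‖ ^ 2) a :=
    Eventually.of_forall fun t => by
      have := ha t
      beta_reduce
      gcongr
  have h3 := h2.hasDerivAt_eq_zero h1
  set q := (z - γ a) / deriv γ a with hq
  have h4 : z - γ a = q * deriv γ a := by rw [hq]; field_simp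
  have hre : q.re = 0 := by
    have h5 : γ a - z = -(q * deriv γ a) := by rw [← h4]; ring
    rw [h5, Complex.inner] at h3
    have h6 : (deriv γ a * (starRingEnd ℂ) (-(q * deriv γ a))).re =
        -(q.re * Complex.normSq (deriv γ a)) := by
      simp [Complex.normSq_apply]
      ring
    rw [h6] at h3
    have := Complex.normSq_pos.2 hv
    by_contra hne
    have : q.re * Complex.normSq (deriv γ a) ≠ 0 := mul_ne_zero hne this.ne'
    exact this (by linarith)
  have hq2 : q = q.im * Complex.I := by
    apply Complex.ext <;> simp [hre]
  have hz : z = γ a + q.im * Complex.I * deriv γ a := by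
    rw [← hq2, ← h4]; ring
  refine ⟨q.im, hz, ?_⟩
  have h5 : ‖γ a - z‖ = |q.im| * ‖deriv γ a‖ := by
    rw [norm_sub_rev, h4, norm_mul]
    congr 1
    conv_lhs => rw [hq2]
    simp
  rw [h5, mul_comm]
  gcongr
  exact h.le_deriv a

/-- Each component of the complement of the curve contains one of two fixed disjoint nonempty sets,
the one-sided collars: its boundary lies on the curve and is not empty. -/
lemma ChordArc.exists_collars (h : ChordArc γ c L M) : ∃ P Q : Set ℂ, P.Nonempty ∧ Q.Nonempty ∧
    ∀ z ∉ range γ, P ⊆ connectedComponentIn (range γ)ᶜ z ∨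
      Q ⊆ connectedComponentIn (range γ)ᶜ z := by
  have hc := h.pos
  have hM := h.M_nonneg
  have hL := h.L_nonneg
  set ε := c ^ 2 / (M * L + 1) with hε
  have hε0 : 0 < ε := by positivity
  have hML : ∀ s : ℝ, |s| < ε → M * L * |s| < c ^ 2 := by
    intro s hs
    rw [hε, lt_div_iff₀ (by positivity)] at hs
    nlinarith [abs_nonneg s]
  have hP : collar γ (Ioo 0 ε) ⊆ (range γ)ᶜ := by
    rintro _ ⟨⟨t, s⟩, ⟨-, hs⟩, rfl⟩
    exact h.normal_notMem_range t hs.1.ne' (hML s (by rw [abs_of_pos hs.1]; exact hs.2))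
  have hQ : collar γ (Ioo (-ε) 0) ⊆ (range γ)ᶜ := by
    rintro _ ⟨⟨t, s⟩, ⟨-, hs⟩, rfl⟩
    exact h.normal_notMem_range t hs.2.ne (hML s (by rw [abs_of_neg hs.2]; linarith [hs.1]))
  refine ⟨collar γ (Ioo 0 ε), collar γ (Ioo (-ε) 0), ?_, ?_, fun z hz => ?_⟩
  · exact (univ_nonempty.prod (nonempty_Ioo.2 hε0)).image _
  · exact (univ_nonempty.prod (nonempty_Ioo.2 (by linarith))).image _
  have hopen : IsOpen (range γ)ᶜ := h.isCompact_range.isClosed.isOpen_compl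
  set V := connectedComponentIn (range γ)ᶜ z with hV
  have hVo : IsOpen V := hopen.connectedComponentIn
  have hzV : z ∈ V := mem_connectedComponentIn hz
  have hVne : V ≠ univ := fun hu => by
    have : γ 0 ∈ V := hu ▸ mem_univ _
    exact connectedComponentIn_subset _ _ this (mem_range_self 0)
  obtain ⟨x, hx⟩ := nonempty_frontier_iff.2 ⟨⟨z, hzV⟩, hVne⟩
  have hxΓ : x ∈ range γ := by
    by_contra hxn
    have hxo : IsOpen (connectedComponentIn (range γ)ᶜ x) := hopen.connectedComponentIn
    obtain ⟨y, hy1, hy2⟩ := mem_closure_iff.1 hx.1 _ hxo (mem_connectedComponentIn hxn)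
    have e := (connectedComponentIn_eq hy1).trans (connectedComponentIn_eq hy2).symm
    have : x ∈ V := by
      rw [hV, ← e]; exact mem_connectedComponentIn hxn
    rw [hVo.frontier_eq] at hx
    exact hx.2 this
  obtain ⟨b, rfl⟩ := hxΓ
  obtain ⟨y, hyV, hyb⟩ := Metric.mem_closure_iff.1 hx.1 (c * ε) (by positivity)
  obtain ⟨s, hs, hsc⟩ := h.exists_eq_normal (nearestParam_spec h y)
  have hy : y ∉ range γ := connectedComponentIn_subset _ _ hyV
  have hsε : |s| < ε := by
    have h1 := nearestParam_spec h y b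
    rw [dist_eq_norm] at hyb
    exact lt_of_mul_lt_mul_left ((hsc.trans h1).trans_lt hyb) hc.le
  have hs0 : s ≠ 0 := by
    rintro rfl
    apply hy
    rw [hs]
    simp
  rw [hV, connectedComponentIn_eq hyV]
  rcases lt_or_gt_of_ne hs0 with hneg | hpos
  · right
    refine (h.isPreconnected_collar (convex_Ioo _ _)).subset_connectedComponentIn ?_ hQ
    exact ⟨⟨_, s⟩, ⟨mem_univ _, by rw [abs_of_neg hneg] at hsε; linarith, hneg⟩, hs.symm⟩
  · left
    refine (h.isPreconnected_collar (convex_Ioo _ _)).subset_connectedComponentIn ?_ hP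
    exact ⟨⟨_, s⟩, ⟨mem_univ _, hpos, by rwa [abs_of_pos hpos] at hsε⟩, hs.symm⟩

lemma IsJordanDomain.compl_range {Ω : Set ℂ} (hΩ : IsJordanDomain γ Ω) :
    (range γ)ᶜ = Ω ∪ (closure Ω)ᶜ := by
  rw [← hΩ.frontier_eq, hΩ.isOpen.frontier_eq]
  ext z
  have := @subset_closure _ _ Ω z
  simp only [mem_compl_iff, Set.mem_sdiff, mem_union]
  tauto

/-- The exterior is a single component: one collar belongs to `Ω`, so every exterior component
contains the other one. -/
lemma IsJordanDomain.mem_connectedComponentIn_exterior {Ω : Set ℂ} (hΩ : IsJordanDomain γ Ω)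
    {z w : ℂ} (hz : z ∈ (closure Ω)ᶜ) (hw : w ∈ (closure Ω)ᶜ) :
    w ∈ connectedComponentIn (range γ)ᶜ z := by
  obtain ⟨c, L, M, h⟩ := hΩ.curve.exists_chordArc
  obtain ⟨P, Q, ⟨p, hp⟩, ⟨q, hq⟩, hPQ⟩ := h.exists_collars
  obtain ⟨x, hx⟩ := hΩ.isConnected.nonempty
  have hcompl := hΩ.compl_range
  have hext : IsOpen (closure Ω)ᶜ := isClosed_closure.isOpen_compl
  have hdisj : Disjoint Ω (closure Ω)ᶜ := disjoint_compl_right_iff_subset.2 subset_closure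
  have hxn : x ∈ (range γ)ᶜ := hcompl ▸ Or.inl hx
  have hzn : z ∈ (range γ)ᶜ := hcompl ▸ Or.inr hz
  have hwn : w ∈ (range γ)ᶜ := hcompl ▸ Or.inr hw
  have hside : ∀ y : ℂ, connectedComponentIn (range γ)ᶜ y ⊆ Ω ∨
      connectedComponentIn (range γ)ᶜ y ⊆ (closure Ω)ᶜ := fun y =>
    isPreconnected_connectedComponentIn.subset_or_subset hΩ.isOpen hext hdisj
      (hcompl ▸ connectedComponentIn_subset _ _)
  have hin : connectedComponentIn (range γ)ᶜ x ⊆ Ω :=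
    (hside x).resolve_right fun hs => hs (mem_connectedComponentIn hxn) (subset_closure hx)
  have hout : ∀ y ∈ (closure Ω)ᶜ, connectedComponentIn (range γ)ᶜ y ⊆ (closure Ω)ᶜ := fun y hy =>
    (hside y).resolve_left fun hs =>
      hy (subset_closure (hs (mem_connectedComponentIn (hcompl ▸ Or.inr hy))))
  have hmeet : ∀ y ∈ connectedComponentIn (range γ)ᶜ z, y ∈ connectedComponentIn (range γ)ᶜ w →
      w ∈ connectedComponentIn (range γ)ᶜ z := by
    intro y h1 h2
    rw [connectedComponentIn_eq h1, ← connectedComponentIn_eq h2]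
    exact mem_connectedComponentIn hwn
  rcases hPQ x hxn with h1 | h1 <;> rcases hPQ z hzn with h2 | h2 <;>
    rcases hPQ w hwn with h3 | h3
  · exact hmeet p (h2 hp) (h3 hp)
  · exact absurd (subset_closure (hin (h1 hp))) (hout z hz (h2 hp))
  · exact absurd (subset_closure (hin (h1 hp))) (hout w hw (h3 hp))
  · exact hmeet q (h2 hq) (h3 hq)
  · exact hmeet p (h2 hp) (h3 hp)
  · exact absurd (subset_closure (hin (h1 hq))) (hout w hw (h3 hq))
  · exact absurd (subset_closure (hin (h1 hq))) (hout z hz (h2 hq))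
  · exact hmeet q (h2 hq) (h3 hq)

lemma IsJordanDomain.compl_closure_mem_cocompact {Ω : Set ℂ} (hΩ : IsJordanDomain γ Ω) :
    (closure Ω)ᶜ ∈ cocompact ℂ :=
  hΩ.isBounded.isCompact_closure.compl_mem_cocompact

/-- The winding number vanishes in the exterior, which is connected and unbounded. -/
lemma IsJordanDomain.windingNumber_exterior {Ω : Set ℂ} (hΩ : IsJordanDomain γ Ω) {z : ℂ}
    (hz : z ∈ (closure Ω)ᶜ) : windingNumber γ z = 0 := by
  obtain ⟨c, L, M, h⟩ := hΩ.curve.exists_chordArc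
  have hopen : IsOpen (range γ)ᶜ := h.isCompact_range.isClosed.isOpen_compl
  have hzn : z ∈ (range γ)ᶜ := hΩ.compl_range ▸ Or.inr hz
  have hconst : ∀ w ∈ (closure Ω)ᶜ, windingNumber γ w = windingNumber γ z := by
    intro w hw
    refine hopen.connectedComponentIn.is_const_of_deriv_eq_zero
      (isPreconnected_connectedComponentIn (x := z)) (fun y hy => ?_) (fun y hy => ?_)
      (hΩ.mem_connectedComponentIn_exterior hz hw) (mem_connectedComponentIn hzn)
    · exact (hasDerivAt_windingNumber h
        (connectedComponentIn_subset _ _ hy)).differentiableAt.differentiableWithinAt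
    · exact (hasDerivAt_windingNumber h (connectedComponentIn_subset _ _ hy)).deriv
  have hlim : Tendsto (windingNumber γ) (cocompact ℂ) (𝓝 0) := by
    rw [windingNumber_eq_cauchyIntegral]
    exact tendsto_cauchyIntegral_cocompact h continuous_const fun _ => rfl
  refine tendsto_nhds_unique (tendsto_const_nhds.congr' ?_) hlim
  filter_upwards [hΩ.compl_closure_mem_cocompact] with w hw
  exact (hconst w hw).symm

end

variable {γ φ : ℝ → ℂ} {c L M A : ℝ} {σ : ℝ≥0} {Ω : Set ℂ}

/-! ### Boundary values of Cauchy integrals and the reproducing property -/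

lemma IsJordanDomain.compl_eq (hΩ : IsJordanDomain γ Ω) : (closure Ω)ᶜ ∪ frontier Ω = Ωᶜ := by
  rw [hΩ.isOpen.frontier_eq]
  ext z
  have := @subset_closure _ _ Ω z
  simp only [mem_compl_iff, Set.mem_sdiff, mem_union]
  tauto

lemma IsJordanDomain.notMem_range_of_mem (hΩ : IsJordanDomain γ Ω) {z : ℂ} (hz : z ∈ Ω) :
    z ∉ range γ := fun h => by
  have : z ∈ (range γ)ᶜ := hΩ.compl_range ▸ Or.inl hz
  exact this h

lemma IsJordanDomain.notMem_range_of_mem_exterior (hΩ : IsJordanDomain γ Ω) {z : ℂ}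
    (hz : z ∈ (closure Ω)ᶜ) : z ∉ range γ := fun h => by
  have : z ∈ (range γ)ᶜ := hΩ.compl_range ▸ Or.inr hz
  exact this h

lemma IsJordanDomain.mem_closure (hΩ : IsJordanDomain γ Ω) (t : ℝ) : γ t ∈ closure Ω :=
  frontier_subset_closure (hΩ.frontier_eq ▸ mem_range_self t)

lemma IsJordanDomain.mem_compl (hΩ : IsJordanDomain γ Ω) (t : ℝ) : γ t ∈ Ωᶜ :=
  fun h => hΩ.notMem_range_of_mem h (mem_range_self t)

lemma IsJordanDomain.coe_mem_frontier (hΩ : IsJordanDomain γ Ω) (ζ : range γ) :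
    (ζ : ℂ) ∈ frontier Ω := by
  rw [hΩ.frontier_eq]
  exact ζ.2

lemma IsJordanDomain.coe_mem_closure (hΩ : IsJordanDomain γ Ω) (ζ : range γ) :
    (ζ : ℂ) ∈ closure Ω := frontier_subset_closure (hΩ.coe_mem_frontier ζ)

lemma holderOnWith_of_norm_sub_le {f : ℂ → ℂ} {S : Set ℂ} {C : ℝ}
    (h : ∀ z ∈ S, ∀ w ∈ S, ‖f z - f w‖ ≤ C * ‖z - w‖ ^ (σ : ℝ)) :
    HolderOnWith C.toNNReal σ f S := by
  intro z hz w hw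
  have h1 : nndist (f z) (f w) ≤ C.toNNReal * nndist z w ^ (σ : ℝ) := by
    rw [← NNReal.coe_le_coe]
    push_cast
    rw [dist_eq_norm, dist_eq_norm]
    refine (h z hz w hw).trans ?_
    gcongr
    exact Real.le_coe_toNNReal C
  rw [edist_nndist, edist_nndist, ← ENNReal.coe_rpow_of_nonneg _ σ.coe_nonneg]
  exact_mod_cast h1

lemma cauchyExtension_one_eq (hΩ : IsJordanDomain γ Ω) (h : ChordArc γ c L M)
    (hφ : Continuous φ) {z : ℂ} (hz : z ∈ Ω) :
    cauchyExtension γ φ 1 z = cauchyIntegral γ φ z := by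
  rw [← cauchyExtension_eq_cauchyIntegral h hφ (hΩ.notMem_range_of_mem hz),
    show windingNumber γ z = 1 from hΩ.winding z hz]

lemma cauchyExtension_zero_eq (hΩ : IsJordanDomain γ Ω) (h : ChordArc γ c L M)
    (hφ : Continuous φ) {z : ℂ} (hz : z ∈ (closure Ω)ᶜ) :
    cauchyExtension γ φ 0 z = cauchyIntegral γ φ z := by
  rw [← cauchyExtension_eq_cauchyIntegral h hφ (hΩ.notMem_range_of_mem_exterior hz),
    hΩ.windingNumber_exterior hz]

lemma isInteriorHolder_cauchyExtension (hΩ : IsJordanDomain γ Ω) (h : ChordArc γ c L M)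
    (hφ : HolderDensity γ φ A σ) (hσ0 : 0 < σ) (hσ1 : σ < 1) :
    IsInteriorHolder σ Ω (cauchyExtension γ φ 1) := by
  constructor
  · obtain ⟨C, -, hC⟩ := exists_norm_cauchyExtension_sub_le h hφ
      (NNReal.coe_pos.2 hσ0) (by exact_mod_cast hσ1) 1
    refine ⟨_, holderOnWith_of_norm_sub_le (hC (closure Ω) fun z hz hzn => ?_)⟩
    have : z ∈ Ω := by
      have h1 : z ∈ (range γ)ᶜ := hzn
      rw [hΩ.compl_range] at h1
      exact h1.resolve_right fun h2 => h2 hz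
    exact hΩ.winding z this
  · intro z hz
    have h1 := (hasDerivAt_cauchyIntegral h hφ.continuous
      (hΩ.notMem_range_of_mem hz)).differentiableAt.differentiableWithinAt (s := Ω)
    exact h1.congr (fun w hw => cauchyExtension_one_eq hΩ h hφ.continuous hw)
      (cauchyExtension_one_eq hΩ h hφ.continuous hz)

lemma isExteriorHolder_cauchyExtension (hΩ : IsJordanDomain γ Ω) (h : ChordArc γ c L M)
    (hφ : HolderDensity γ φ A σ) (hσ0 : 0 < σ) (hσ1 : σ < 1) :
    IsExteriorHolder σ Ω (cauchyExtension γ φ 0) := by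
  refine ⟨?_, fun z hz => ?_, ?_⟩
  · obtain ⟨C, -, hC⟩ := exists_norm_cauchyExtension_sub_le h hφ
      (NNReal.coe_pos.2 hσ0) (by exact_mod_cast hσ1) 0
    refine ⟨_, holderOnWith_of_norm_sub_le (hC _ fun z hz hzn => ?_)⟩
    rw [hΩ.frontier_eq] at hz
    exact hΩ.windingNumber_exterior (hz.resolve_right hzn)
  · have h1 := (hasDerivAt_cauchyIntegral h hφ.continuous
      (hΩ.notMem_range_of_mem_exterior hz)).differentiableAt.differentiableWithinAt
        (s := (closure Ω)ᶜ)
    exact h1.congr (fun w hw => cauchyExtension_zero_eq hΩ h hφ.continuous hw)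
      (cauchyExtension_zero_eq hΩ h hφ.continuous hz)
  · refine (tendsto_cauchyIntegral_cocompact h hφ.continuous hφ.periodic).congr' ?_
    filter_upwards [hΩ.compl_closure_mem_cocompact] with w hw
    exact (cauchyExtension_zero_eq hΩ h hφ.continuous hw).symm

lemma IsExteriorHolder.neg {g : ℂ → ℂ} (hg : IsExteriorHolder σ Ω g) :
    IsExteriorHolder σ Ω (-g) := by
  obtain ⟨⟨C, hC⟩, hd, h0⟩ := hg
  exact ⟨⟨C, fun z hz w hw => by simpa [edist_neg_neg] using hC z hz w hw⟩, hd.neg,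
    by have := h0.neg; rw [neg_zero] at this; exact this⟩

/-- An interior and an exterior function with the same boundary values form a bounded entire
function vanishing at infinity. -/
theorem eq_zero_of_eqOn_boundary (hΩ : IsJordanDomain γ Ω) {f g : ℂ → ℂ}
    (hfc : ContinuousOn f (closure Ω)) (hfd : DifferentiableOn ℂ f Ω)
    (hgc : ContinuousOn g Ωᶜ) (hgd : DifferentiableOn ℂ g (closure Ω)ᶜ)
    (hg0 : Tendsto g (cocompact ℂ) (𝓝 0)) (hfg : ∀ t, f (γ t) = g (γ t)) :
    (∀ z ∈ closure Ω, f z = 0) ∧ ∀ z ∈ Ωᶜ, g z = 0 := by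
  classical
  set k : ℂ → ℂ := (closure Ω).piecewise f g with hk
  have k1 : EqOn k f (closure Ω) := piecewise_eqOn _ _ _
  have k2 : EqOn k g Ωᶜ := by
    intro z hz
    by_cases hzc : z ∈ closure Ω
    · have : z ∈ range γ := by
        rw [← hΩ.frontier_eq, hΩ.isOpen.frontier_eq]; exact ⟨hzc, hz⟩
      obtain ⟨t, rfl⟩ := this
      rw [k1 hzc, hfg]
    · exact piecewise_eqOn_compl _ _ _ hzc
  have hkc : Continuous k := by
    rw [← continuousOn_univ]
    have hu : (univ : Set ℂ) = closure Ω ∪ Ωᶜ := by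
      ext z
      have := @subset_closure _ _ Ω z
      simp only [mem_univ, mem_union, mem_compl_iff, true_iff]
      tauto
    rw [hu]
    exact (hfc.congr k1).union_of_isClosed (hgc.congr k2) isClosed_closure
      hΩ.isOpen.isClosed_compl
  have hkd : ∀ z ∉ range γ, DifferentiableAt ℂ k z := by
    intro z hz
    have h1 : z ∈ (range γ)ᶜ := hz
    rw [hΩ.compl_range] at h1
    rcases h1 with h1 | h1
    · exact (hfd.congr (k1.mono subset_closure)).differentiableAt (hΩ.isOpen.mem_nhds h1)
    · exact (hgd.congr (k2.mono (compl_subset_compl.2 subset_closure))).differentiableAt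
        (isClosed_closure.isOpen_compl.mem_nhds h1)
  have hk0 : Tendsto k (cocompact ℂ) (𝓝 0) := by
    refine hg0.congr' ?_
    filter_upwards [hΩ.compl_closure_mem_cocompact] with w hw
    exact (k2 (compl_subset_compl.2 subset_closure hw)).symm
  have := hΩ.curve.eq_zero_of_tendsto_zero hkc hkd hk0
  exact ⟨fun z hz => k1 hz ▸ this z, fun z hz => k2 hz ▸ this z⟩

lemma IsInteriorHolder.continuousOn {f : ℂ → ℂ} (hf : IsInteriorHolder σ Ω f) (hσ0 : 0 < σ) :
    ContinuousOn f (closure Ω) := hf.1.choose_spec.continuousOn hσ0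

lemma IsExteriorHolder.continuousOn (hΩ : IsJordanDomain γ Ω) {g : ℂ → ℂ}
    (hg : IsExteriorHolder σ Ω g) (hσ0 : 0 < σ) : ContinuousOn g Ωᶜ := by
  have := hg.1.choose_spec.continuousOn hσ0
  rwa [hΩ.compl_eq] at this

/-- The Cauchy integral of the boundary values of an interior function is that function inside. -/
lemma IsInteriorHolder.cauchyExtension_one (hΩ : IsJordanDomain γ Ω) (h : ChordArc γ c L M)
    (hφ : HolderDensity γ φ A σ) (hσ0 : 0 < σ) (hσ1 : σ < 1) {f : ℂ → ℂ}
    (hf : IsInteriorHolder σ Ω f) (hφf : ∀ t, φ t = f (γ t)) {z : ℂ} (hz : z ∈ closure Ω) :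
    cauchyExtension γ φ 1 z = f z := by
  have i := isInteriorHolder_cauchyExtension hΩ h hφ hσ0 hσ1
  have e := isExteriorHolder_cauchyExtension hΩ h hφ hσ0 hσ1
  refine sub_eq_zero.1 ((eq_zero_of_eqOn_boundary hΩ (f := cauchyExtension γ φ 1 - f)
    ((i.continuousOn hσ0).sub (hf.continuousOn hσ0)) (i.2.sub hf.2)
    (e.continuousOn hΩ hσ0) e.2.1 e.2.2 fun t => ?_).1 z hz)
  have := cauchyExtension_one_sub_zero h hφ (NNReal.coe_pos.2 hσ0) t
  rw [Pi.sub_apply, ← hφf, ← this]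
  ring

/-- The Cauchy integral of the boundary values of an exterior function vanishes inside. -/
lemma IsExteriorHolder.cauchyExtension_one (hΩ : IsJordanDomain γ Ω) (h : ChordArc γ c L M)
    (hφ : HolderDensity γ φ A σ) (hσ0 : 0 < σ) (hσ1 : σ < 1) {g : ℂ → ℂ}
    (hg : IsExteriorHolder σ Ω g) (hφg : ∀ t, φ t = g (γ t)) {z : ℂ} (hz : z ∈ closure Ω) :
    cauchyExtension γ φ 1 z = 0 := by
  have i := isInteriorHolder_cauchyExtension hΩ h hφ hσ0 hσ1
  have e := isExteriorHolder_cauchyExtension hΩ h hφ hσ0 hσ1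
  refine (eq_zero_of_eqOn_boundary hΩ (g := cauchyExtension γ φ 0 + g)
    (i.continuousOn hσ0) i.2 ((e.continuousOn hΩ hσ0).add (hg.continuousOn hΩ hσ0))
    (e.2.1.add hg.2.1) (by have := e.2.2.add hg.2.2; rw [add_zero] at this; exact this)
    fun t => ?_).1 z hz
  have := cauchyExtension_one_sub_zero h hφ (NNReal.coe_pos.2 hσ0) t
  rw [Pi.add_apply, ← hφg, ← this]
  ring

/-! ### The operators on the Hölder space -/

/-- A function on the curve as a function of the parameter. -/
def density (γ : ℝ → ℂ) (F : range γ → ℂ) (t : ℝ) : ℂ := F (rangeFactorization γ t)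

lemma exists_holderDensity (h : ChordArc γ c L M) (hσ0 : 0 < σ) {F : range γ → ℂ}
    (hF : F ∈ HolderSpace σ (range γ)) : ∃ A, HolderDensity γ (density γ F) A σ := by
  obtain ⟨C, hC⟩ := hF
  refine ⟨C, (hC.continuous hσ0).comp h.differentiable.continuous.rangeFactorization,
    fun t => ?_, C.coe_nonneg, fun s t => ?_⟩
  · exact congrArg F (Subtype.ext (h.periodic t))
  · have := hC.dist_le (rangeFactorization γ t) (rangeFactorization γ s)
    rwa [dist_eq_norm, Subtype.dist_eq, dist_eq_norm] at this

lemma conjOp_mem {Γ : Set ℂ} {F : Γ → ℂ} (hF : F ∈ HolderSpace σ Γ) :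
    conjOp F ∈ HolderSpace σ Γ := by
  obtain ⟨C, hC⟩ := hF
  refine ⟨C, fun z w => ?_⟩
  rw [show edist (conjOp F z) (conjOp F w) = edist (F z) (F w) by
    simp only [conjOp]
    exact Complex.isometry_conj.edist_eq _ _]
  exact hC z w

lemma holderWith_of_holderOnWith {f : ℂ → ℂ} {C : ℝ≥0} {S : Set ℂ} (hf : HolderOnWith C σ f S)
    {Γ : Set ℂ} (hΓ : Γ ⊆ S) : Γ.domRestrict f ∈ HolderSpace σ Γ :=
  ⟨C, HolderWith.restrict_iff.2 (hf.mono hΓ)⟩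

lemma tendsto_cauchyTransform (hΩ : IsJordanDomain γ Ω) (hσ0 : 0 < σ) (hσ1 : σ < 1)
    {F : range γ → ℂ} (hF : F ∈ HolderSpace σ (range γ)) (ζ : range γ) :
    Tendsto (cauchyTransform γ F) (𝓝[Ω] (ζ : ℂ))
      (𝓝 (cauchyExtension γ (density γ F) 1 ζ)) := by
  obtain ⟨c, L, M, h⟩ := hΩ.curve.exists_chordArc
  obtain ⟨A, hφ⟩ := exists_holderDensity h hσ0 hF
  have i := isInteriorHolder_cauchyExtension hΩ h hφ hσ0 hσ1
  have h1 : Tendsto (cauchyExtension γ (density γ F) 1) (𝓝[Ω] (ζ : ℂ))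
      (𝓝 (cauchyExtension γ (density γ F) 1 ζ)) :=
    (i.continuousOn hσ0 ζ (hΩ.coe_mem_closure ζ)).mono_left (nhdsWithin_mono _ subset_closure)
  refine h1.congr' ?_
  filter_upwards [self_mem_nhdsWithin] with z hz
  exact cauchyExtension_one_eq hΩ h hφ.continuous hz

lemma IsJordanDomain.neBot (hΩ : IsJordanDomain γ Ω) (ζ : range γ) : (𝓝[Ω] (ζ : ℂ)).NeBot :=
  mem_closure_iff_nhdsWithin_neBot.1 (hΩ.coe_mem_closure ζ)

lemma hilbertOp_apply (hΩ : IsJordanDomain γ Ω) (hσ0 : 0 < σ) (hσ1 : σ < 1)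
    {F : range γ → ℂ} (hF : F ∈ HolderSpace σ (range γ)) (ζ : range γ) :
    hilbertOp γ Ω F ζ = cauchyExtension γ (density γ F) 1 ζ :=
  have := hΩ.neBot ζ
  (tendsto_cauchyTransform hΩ hσ0 hσ1 hF ζ).limUnder_eq

lemma hilbertOp_mem (hΩ : IsJordanDomain γ Ω) (hσ0 : 0 < σ) (hσ1 : σ < 1)
    {F : range γ → ℂ} (hF : F ∈ HolderSpace σ (range γ)) :
    hilbertOp γ Ω F ∈ HolderSpace σ (range γ) := by
  obtain ⟨c, L, M, h⟩ := hΩ.curve.exists_chordArc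
  obtain ⟨A, hφ⟩ := exists_holderDensity h hσ0 hF
  obtain ⟨⟨C, hC⟩, -⟩ := isInteriorHolder_cauchyExtension hΩ h hφ hσ0 hσ1
  rw [show hilbertOp γ Ω F = (range γ).domRestrict (cauchyExtension γ (density γ F) 1) from
    funext fun ζ => hilbertOp_apply hΩ hσ0 hσ1 hF ζ]
  exact holderWith_of_holderOnWith hC (hΩ.frontier_eq ▸ frontier_subset_closure)

lemma hasDerivAt_log_norm {u v : ℂ} (hu : u ≠ 0) :
    HasDerivAt (fun s : ℝ => Real.log ‖u - s * v‖) (-(v / u).re) 0 := by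
  have h1 : HasDerivAt (fun s : ℝ => u - s * v) (-v) 0 := by
    have := ((hasDerivAt_id (0 : ℝ)).ofReal_comp.mul_const v).const_sub u
    simpa using this
  have h2 := (h1.norm_sq.log (by simpa using hu)).const_mul (1 / 2)
  have e : (fun s : ℝ => Real.log ‖u - s * v‖) =
      fun s : ℝ => 1 / 2 * Real.log (‖u - s * v‖ ^ 2) := by
    ext s
    rw [Real.log_pow]
    push_cast
    ring
  rw [e]
  refine h2.congr_deriv ?_
  have hn : Complex.normSq u ≠ 0 := (Complex.normSq_pos.2 hu).ne'
  simp only [Complex.ofReal_zero, zero_mul, sub_zero, Complex.inner, Complex.sq_norm,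
    Complex.div_re]
  simp
  field_simp

/-- The kernel of the double layer potential, computed from the tangent. -/
lemma lineDeriv_log_mul {t : ℝ} {z : ℂ} (hz : γ t ≠ z) (hd : deriv γ t ≠ 0) :
    lineDeriv ℝ (fun ζ : ℂ => Real.log ‖z - ζ‖) (γ t) (outwardNormal γ t) * ‖deriv γ t‖ =
      (deriv γ t / (γ t - z)).im := by
  have h1 : lineDeriv ℝ (fun ζ : ℂ => Real.log ‖z - ζ‖) (γ t) (outwardNormal γ t) =
      -(outwardNormal γ t / (z - γ t)).re := by
    rw [lineDeriv, ← (hasDerivAt_log_norm (u := z - γ t) (v := outwardNormal γ t)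
      (sub_ne_zero.2 hz.symm)).deriv]
    congr 1
    ext s
    rw [Complex.real_smul, sub_add_eq_sub_sub]
  have hn : (‖deriv γ t‖ : ℂ) ≠ 0 := by
    rw [Complex.ofReal_ne_zero]; exact norm_ne_zero_iff.2 hd
  have h2 : γ t - z ≠ 0 := sub_ne_zero.2 hz
  have h3 : z - γ t ≠ 0 := sub_ne_zero.2 hz.symm
  have h4 : outwardNormal γ t / (z - γ t) * ‖deriv γ t‖ = Complex.I * (deriv γ t / (γ t - z)) := by
    rw [outwardNormal, ← neg_sub (γ t) z]
    field_simp
  have h5 := congrArg Complex.re h4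
  rw [Complex.re_mul_ofReal, Complex.I_mul_re] at h5
  rw [h1]
  linarith

/-- The double layer potential in terms of Cauchy integrals, off the curve. -/
lemma doubleLayerPotential_eq (h : ChordArc γ c L M) {F : range γ → ℂ}
    (hF : Continuous (density γ F)) {z : ℂ} (hz : z ∉ range γ) :
    doubleLayerPotential γ F z =
      cauchyTransform γ F z + conj (cauchyTransform γ (conjOp F) z) := by
  have hpi : (Real.pi : ℂ) ≠ 0 := by exact_mod_cast Real.pi_ne_zero
  have hF' : Continuous (density γ (conjOp F)) := Complex.continuous_conj.comp hF
  have c1 : Continuous fun t => F (rangeFactorization γ t) / (γ t - z) * deriv γ t :=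
    continuous_div_sub_mul_deriv h hF hz
  have c2 : Continuous fun t =>
      conj (conjOp F (rangeFactorization γ t) / (γ t - z) * deriv γ t) :=
    Complex.continuous_conj.comp (continuous_div_sub_mul_deriv h hF' hz)
  have hconj : conj (∫ t in (0 : ℝ)..2 * Real.pi,
      conjOp F (rangeFactorization γ t) / (γ t - z) * deriv γ t) =
      ∫ t in (0 : ℝ)..2 * Real.pi,
        conj (conjOp F (rangeFactorization γ t) / (γ t - z) * deriv γ t) := by
    rw [intervalIntegral.integral_of_le Real.two_pi_pos.le,
      intervalIntegral.integral_of_le Real.two_pi_pos.le, integral_conj]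
  have key : ∫ t in (0 : ℝ)..2 * Real.pi, F (rangeFactorization γ t) *
      ((lineDeriv ℝ (fun ζ : ℂ => Real.log ‖z - ζ‖) (γ t) (outwardNormal γ t) *
        ‖deriv γ t‖ : ℝ) : ℂ) = (2 * Complex.I)⁻¹ *
      ((∫ t in (0 : ℝ)..2 * Real.pi, F (rangeFactorization γ t) / (γ t - z) * deriv γ t) -
        ∫ t in (0 : ℝ)..2 * Real.pi,
          conj (conjOp F (rangeFactorization γ t) / (γ t - z) * deriv γ t)) := by
    rw [← intervalIntegral.integral_sub (c1.intervalIntegrable _ _) (c2.intervalIntegrable _ _),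
      ← intervalIntegral.integral_const_mul]
    congr 1
    ext t
    have hne : γ t ≠ z := fun h0 => hz ⟨t, h0⟩
    rw [lineDeriv_log_mul hne (norm_pos_iff.1 (h.pos.trans_le (h.le_deriv t)))]
    set q := deriv γ t / (γ t - z) with hq
    have e1 : F (rangeFactorization γ t) / (γ t - z) * deriv γ t =
        F (rangeFactorization γ t) * q := by rw [hq]; ring
    have e2 : conj (conjOp F (rangeFactorization γ t) / (γ t - z) * deriv γ t) =
        F (rangeFactorization γ t) * conj q := by
      rw [show conjOp F (rangeFactorization γ t) / (γ t - z) * deriv γ t =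
        conjOp F (rangeFactorization γ t) * q by rw [hq]; ring, map_mul, conjOp,
        Complex.conj_conj]
    have e3 : (q.im : ℂ) = (2 * Complex.I)⁻¹ * (q - conj q) := by
      rw [Complex.sub_conj]
      field_simp
      push_cast
      ring
    rw [e1, e2, e3]
    ring
  rw [doubleLayerPotential, key, cauchyTransform, cauchyTransform, map_mul, hconj, map_inv₀,
    map_mul, map_mul, Complex.conj_I, Complex.conj_ofReal, Complex.conj_ofNat]
  field_simp
  ring

lemma tendsto_doubleLayerPotential (hΩ : IsJordanDomain γ Ω) (hσ0 : 0 < σ) (hσ1 : σ < 1)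
    {F : range γ → ℂ} (hF : F ∈ HolderSpace σ (range γ)) (ζ : range γ) :
    Tendsto (doubleLayerPotential γ F) (𝓝[Ω] (ζ : ℂ))
      (𝓝 (cauchyExtension γ (density γ F) 1 ζ +
        conj (cauchyExtension γ (density γ (conjOp F)) 1 ζ))) := by
  obtain ⟨c, L, M, h⟩ := hΩ.curve.exists_chordArc
  obtain ⟨A, hφ⟩ := exists_holderDensity h hσ0 hF
  refine ((tendsto_cauchyTransform hΩ hσ0 hσ1 hF ζ).add
    ((Complex.continuous_conj.tendsto _).comp
      (tendsto_cauchyTransform hΩ hσ0 hσ1 (conjOp_mem hF) ζ))).congr' ?_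
  filter_upwards [self_mem_nhdsWithin] with z hz
  exact (doubleLayerPotential_eq h hφ.continuous (hΩ.notMem_range_of_mem hz)).symm

lemma doubleLayerOp_apply (hΩ : IsJordanDomain γ Ω) (hσ0 : 0 < σ) (hσ1 : σ < 1)
    {F : range γ → ℂ} (hF : F ∈ HolderSpace σ (range γ)) (ζ : range γ) :
    doubleLayerOp γ Ω F ζ = cauchyExtension γ (density γ F) 1 ζ +
        conj (cauchyExtension γ (density γ (conjOp F)) 1 ζ) :=
  have := hΩ.neBot ζ
  (tendsto_doubleLayerPotential hΩ hσ0 hσ1 hF ζ).limUnder_eq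

lemma doubleLayerOp_eq (hΩ : IsJordanDomain γ Ω) (hσ0 : 0 < σ) (hσ1 : σ < 1)
    {F : range γ → ℂ} (hF : F ∈ HolderSpace σ (range γ)) :
    doubleLayerOp γ Ω F = hilbertOp γ Ω F + conjOp (hilbertOp γ Ω (conjOp F)) := by
  ext ζ
  rw [doubleLayerOp_apply hΩ hσ0 hσ1 hF, Pi.add_apply, conjOp, hilbertOp_apply hΩ hσ0 hσ1 hF,
    hilbertOp_apply hΩ hσ0 hσ1 (conjOp_mem hF)]

lemma add_mem_holderSpace {Γ : Set ℂ} {F G : Γ → ℂ} (hF : F ∈ HolderSpace σ Γ)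
    (hG : G ∈ HolderSpace σ Γ) : F + G ∈ HolderSpace σ Γ := by
  obtain ⟨C, hC⟩ := hF
  obtain ⟨D, hD⟩ := hG
  exact ⟨C + D, hC.add hD⟩

/-! ### Fixed points and matching pairs -/

/-- Complex conjugate boundary values of an interior and an exterior function are both fixed by the
double layer operator. -/
lemma doubleLayerOp_eq_self (hΩ : IsJordanDomain γ Ω) (hσ0 : 0 < σ) (hσ1 : σ < 1) {f g : ℂ → ℂ}
    (hf : IsInteriorHolder σ Ω f) (hg : IsExteriorHolder σ Ω g)
    (hfg : ∀ ζ ∈ frontier Ω, f ζ = conj (g ζ)) :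
    (range γ).domRestrict f ∈ HolderSpace σ (range γ) ∧
      doubleLayerOp γ Ω ((range γ).domRestrict f) = (range γ).domRestrict f ∧
      doubleLayerOp γ Ω ((range γ).domRestrict g) = (range γ).domRestrict g := by
  obtain ⟨c, L, M, h⟩ := hΩ.curve.exists_chordArc
  have hfr := hΩ.frontier_eq
  have hfm : (range γ).domRestrict f ∈ HolderSpace σ (range γ) :=
    holderWith_of_holderOnWith hf.1.choose_spec (hfr ▸ frontier_subset_closure)
  have hgm : (range γ).domRestrict g ∈ HolderSpace σ (range γ) :=
    holderWith_of_holderOnWith hg.1.choose_spec (hfr ▸ subset_union_right)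
  have hcf : conjOp ((range γ).domRestrict f) = (range γ).domRestrict g := by
    ext ζ
    simp only [conjOp, domRestrict_apply, hfg ζ (hΩ.coe_mem_frontier ζ), Complex.conj_conj]
  have hcg : conjOp ((range γ).domRestrict g) = (range γ).domRestrict f := by
    ext ζ
    simp only [conjOp, domRestrict_apply, hfg ζ (hΩ.coe_mem_frontier ζ)]
  obtain ⟨A, hφf⟩ := exists_holderDensity h hσ0 hfm
  obtain ⟨B, hφg⟩ := exists_holderDensity h hσ0 hgm
  refine ⟨hfm, funext fun ζ => ?_, funext fun ζ => ?_⟩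
  · rw [doubleLayerOp_apply hΩ hσ0 hσ1 hfm, hcf,
      hf.cauchyExtension_one hΩ h hφf hσ0 hσ1 (fun _ => rfl) (hΩ.coe_mem_closure ζ),
      hg.cauchyExtension_one hΩ h hφg hσ0 hσ1 (fun _ => rfl) (hΩ.coe_mem_closure ζ),
      map_zero, add_zero]
    rfl
  · rw [doubleLayerOp_apply hΩ hσ0 hσ1 hgm, hcg,
      hf.cauchyExtension_one hΩ h hφf hσ0 hσ1 (fun _ => rfl) (hΩ.coe_mem_closure ζ),
      hg.cauchyExtension_one hΩ h hφg hσ0 hσ1 (fun _ => rfl) (hΩ.coe_mem_closure ζ), zero_add,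
      hfg ζ (hΩ.coe_mem_frontier ζ), Complex.conj_conj]
    rfl

/-- An interior function with vanishing boundary values is zero. -/
lemma IsInteriorHolder.eq_zero (hΩ : IsJordanDomain γ Ω) (hσ0 : 0 < σ) {f : ℂ → ℂ}
    (hf : IsInteriorHolder σ Ω f) (h0 : ∀ t, f (γ t) = 0) {z : ℂ} (hz : z ∈ closure Ω) :
    f z = 0 :=
  (eq_zero_of_eqOn_boundary hΩ (g := fun _ => 0) (hf.continuousOn hσ0) hf.2 continuousOn_const
    (differentiableOn_const _) tendsto_const_nhds h0).1 z hz

/-- An interior and an exterior function with conjugate boundary values form a matching pair,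
unless they vanish on the boundary. -/
lemma isMatchingPair_or_eq_zero (hΩ : IsJordanDomain γ Ω) (hσ0 : 0 < σ)
    {f g : ℂ → ℂ} (hf : IsInteriorHolder σ Ω f) (hg : IsExteriorHolder σ Ω g)
    (hfg : ∀ t, f (γ t) = conj (g (γ t))) :
    IsMatchingPair σ Ω f g ∨ ∀ t, f (γ t) = 0 := by
  by_cases h1 : ∃ k, ∀ z ∈ closure Ω, f z = k
  · -- The constant `conj k` inside and `g` outside form an entire function.
    obtain ⟨k, hk⟩ := h1
    right
    have hgk : ∀ t, conj k = g (γ t) := fun t => by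
      rw [← hk _ (hΩ.mem_closure t), hfg, Complex.conj_conj]
    have := (eq_zero_of_eqOn_boundary hΩ (f := fun _ => conj k) (g := g) continuousOn_const
      (differentiableOn_const _) (hg.continuousOn hΩ hσ0) hg.2.1 hg.2.2 hgk).2
    intro t
    rw [hfg, this _ (hΩ.mem_compl t), map_zero]
  by_cases h2 : ∃ k, ∀ z ∈ (closure Ω)ᶜ ∪ frontier Ω, g z = k
  · obtain ⟨k, hk⟩ := h2
    right
    have hk0 : k = 0 := by
      refine tendsto_nhds_unique (tendsto_const_nhds.congr' ?_) hg.2.2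
      filter_upwards [hΩ.compl_closure_mem_cocompact] with w hw
      exact (hk w (Or.inl hw)).symm
    intro t
    rw [hfg, hk _ (Or.inr (hΩ.frontier_eq ▸ mem_range_self t)), hk0, map_zero]
  · left
    refine ⟨hf, hg, h1, h2, fun ζ hζ => ?_⟩
    rw [hΩ.frontier_eq] at hζ
    obtain ⟨t, rfl⟩ := hζ
    exact hfg t

/-- A nonzero fixed point of the double layer operator gives a matching pair: if `Φ₁`, `Φ₀` and
`Ψ₁`, `Ψ₀` are the interior and exterior Cauchy integrals of `F` and of `conj F`, the fixed point
equation together with the jump relation says that `Ψ₁ = conj (-Φ₀)` and `Φ₁ = conj (-Ψ₀)` on the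
curve. One of these pairs is nonconstant since `F = Φ₁ + conj Ψ₁`. -/
lemma exists_isMatchingPair (hΩ : IsJordanDomain γ Ω) (hσ0 : 0 < σ) (hσ1 : σ < 1)
    {F : range γ → ℂ} (hF : F ∈ HolderSpace σ (range γ)) (hF0 : F ≠ 0)
    (hfix : doubleLayerOp γ Ω F = F) : ∃ f g : ℂ → ℂ, IsMatchingPair σ Ω f g := by
  obtain ⟨c, L, M, h⟩ := hΩ.curve.exists_chordArc
  obtain ⟨A, hφ⟩ := exists_holderDensity h hσ0 hF
  obtain ⟨B, hψ⟩ := exists_holderDensity h hσ0 (conjOp_mem hF)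
  have hσ0' := NNReal.coe_pos.2 hσ0
  have hsum : ∀ t, cauchyExtension γ (density γ F) 1 (γ t) +
      conj (cauchyExtension γ (density γ (conjOp F)) 1 (γ t)) = density γ F t := by
    intro t
    have := doubleLayerOp_apply hΩ hσ0 hσ1 hF (rangeFactorization γ t)
    rw [hfix] at this
    exact this.symm
  have j1 := cauchyExtension_one_sub_zero h hφ hσ0'
  have j2 : ∀ t, conj (cauchyExtension γ (density γ (conjOp F)) 1 (γ t)) -
      conj (cauchyExtension γ (density γ (conjOp F)) 0 (γ t)) = density γ F t := by
    intro t
    rw [← map_sub, cauchyExtension_one_sub_zero h hψ hσ0']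
    exact Complex.conj_conj _
  rcases isMatchingPair_or_eq_zero hΩ hσ0 (isInteriorHolder_cauchyExtension hΩ h hψ hσ0 hσ1)
    (isExteriorHolder_cauchyExtension hΩ h hφ hσ0 hσ1).neg (fun t => by
      rw [← Complex.conj_conj (cauchyExtension γ (density γ (conjOp F)) 1 (γ t)), Pi.neg_apply]
      congr 1
      linear_combination hsum t - j1 t) with hp | hz1
  · exact ⟨_, _, hp⟩
  rcases isMatchingPair_or_eq_zero hΩ hσ0 (isInteriorHolder_cauchyExtension hΩ h hφ hσ0 hσ1)
    (isExteriorHolder_cauchyExtension hΩ h hψ hσ0 hσ1).neg (fun t => by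
      rw [Pi.neg_apply, map_neg]
      linear_combination hsum t - j2 t) with hp | hz2
  · exact ⟨_, _, hp⟩
  refine absurd (funext fun ζ => ?_) hF0
  obtain ⟨_, t, rfl⟩ := ζ
  have := hsum t
  rw [hz1, hz2, map_zero, add_zero] at this
  exact this.symm

end DoubleLayer

end

theorem theorem1p20 (σ : ℝ≥0) (hσ0 : 0 < σ) (hσ1 : σ < 1) (γ : ℝ → ℂ) (Ω : Set ℂ)
    (hΩ : DoubleLayer.IsJordanDomain γ Ω) :
    -- the operators `H` and `Π` are well defined on the Hölder space, and `Π = H + C H C`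
    (∀ F ∈ DoubleLayer.HolderSpace σ (range γ),
      DoubleLayer.HasBoundaryValues (range γ) Ω (DoubleLayer.cauchyTransform γ F) ∧
      DoubleLayer.HasBoundaryValues (range γ) Ω (DoubleLayer.doubleLayerPotential γ F) ∧
      DoubleLayer.hilbertOp γ Ω F ∈ DoubleLayer.HolderSpace σ (range γ) ∧
      DoubleLayer.doubleLayerOp γ Ω F ∈ DoubleLayer.HolderSpace σ (range γ) ∧
      DoubleLayer.doubleLayerOp γ Ω F =
        DoubleLayer.hilbertOp γ Ω F +
          DoubleLayer.conjOp (DoubleLayer.hilbertOp γ Ω (DoubleLayer.conjOp F))) ∧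
    -- non-trivial fixed points exist if and only if a matching pair exists
    ((∃ F ∈ DoubleLayer.HolderSpace σ (range γ), F ≠ 0 ∧ DoubleLayer.doubleLayerOp γ Ω F = F) ↔
      ∃ f g : ℂ → ℂ, DoubleLayer.IsMatchingPair σ Ω f g) ∧
    -- both members of a matching pair are fixed points
    (∀ f g : ℂ → ℂ, DoubleLayer.IsMatchingPair σ Ω f g →
      DoubleLayer.doubleLayerOp γ Ω ((range γ).domRestrict f) = (range γ).domRestrict f ∧
      DoubleLayer.doubleLayerOp γ Ω ((range γ).domRestrict g) = (range γ).domRestrict g) := by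
  refine ⟨fun F hF => ?_, ⟨?_, ?_⟩, fun f g hp => ?_⟩
  · have hop := DoubleLayer.doubleLayerOp_eq hΩ hσ0 hσ1 hF
    refine ⟨fun ζ => ⟨_, DoubleLayer.tendsto_cauchyTransform hΩ hσ0 hσ1 hF ζ⟩,
      fun ζ => ⟨_, DoubleLayer.tendsto_doubleLayerPotential hΩ hσ0 hσ1 hF ζ⟩,
      DoubleLayer.hilbertOp_mem hΩ hσ0 hσ1 hF, ?_, hop⟩
    rw [hop]
    exact DoubleLayer.add_mem_holderSpace (DoubleLayer.hilbertOp_mem hΩ hσ0 hσ1 hF)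
      (DoubleLayer.conjOp_mem (DoubleLayer.hilbertOp_mem hΩ hσ0 hσ1 (DoubleLayer.conjOp_mem hF)))
  · rintro ⟨F, hF, hF0, hfix⟩
    exact DoubleLayer.exists_isMatchingPair hΩ hσ0 hσ1 hF hF0 hfix
  · rintro ⟨f, g, hp⟩
    obtain ⟨hm, hfix, -⟩ := DoubleLayer.doubleLayerOp_eq_self hΩ hσ0 hσ1 hp.interior hp.exterior hp.conj_eq
    refine ⟨_, hm, fun h0 => hp.nonconstant_left ⟨0, fun z hz => ?_⟩, hfix⟩
    exact hp.interior.eq_zero hΩ hσ0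
      (fun t => congrFun h0 (rangeFactorization γ t)) hz
  · exact (DoubleLayer.doubleLayerOp_eq_self hΩ hσ0 hσ1 hp.interior hp.exterior hp.conj_eq).2
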